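/- **Setting.** Let $d,L,W,m,n\ge 1$ and $k\ge 4$ be integers, let $\Omega_d=\{y\in\mathbb R^d:\|y\|_2<\tfrac12\}$, and let $\nu_0$ be the uniform distribution on $\Omega_d$. Let $\mathcal T_{d,k}$ be the set of Borel probability measures on $\Omega_d$ that have a $\nu_0$-density $f_\mu>0$ in $C^{k,\alpha}(\Omega_d)$ for some $\alpha\in(0,1]$. *Networks.* Let $\mathtt{ReQU}(x)=\max(x,0)^2$, applied componentwise. $\mathcal{NN}(L,W)$ is the set of time-dependent vector fields $$\eta_\theta(y,t)=w_L\,z_{L-1},\qquad z_0=(y,t)\in\mathbb R^{d+1},\quad z_i=\mathtt{ReQU}(w_iz_{i-1}+b_i)\in\mathbb R^{\ell_i}\ (1\le i\le L-1),\qquad w_L z_{L-1}\in\mathbb R^{d},$$ where $\ell_1,\dots,\ell_{L-1}\le W$, $\ell_L=d\le W$, and all entries of the weights $w_i$ and the biases $b_i$ lie in $[-1,1]$. *Discretized flow.* Let $h=1/m$. A second-order Runge–Kutta step is $\Psi_t^{2,h}(y;\eta)=y+h\,\eta\big(y+\tfrac h2\eta(y,t),\,t+\tfrac h2\big)$, and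 $\Psi^h(\eta)=\Psi^{2,h}_{(m-1)h}(\cdot;\eta)\circ\cdots\circ\Psi^{2,h}_{0}(\cdot;\eta)$. *Hypothesis space.* $\mathcal H=\mathcal H^h_{L,W}$ is the set of probability measures $(\Psi^h(\eta))^{-1}_*\nu_0$ on $\Omega_d$, where $\eta\in\mathcal{NN}(L,W)$ is such that every step $\Psi^{2,h}_{jh}(\cdot;\eta)$, $0\le j<m$, is a bijection of $\Omega_d$ onto itself. *Constants.* Let $R_0=\sqrt{1+\tfrac14}$, $R_{\ell+1}=(2W)^2R_\ell^2$, $\Lambda=\big((2W)^2R_{L-1}\big)^L$ and $\Lambda_Z=(8d\Lambda^5e^{\Lambda})^d$. **Theorem (bound on the expected generalization error).** Assume the step-size condition $h<\frac1{2\Lambda}$. Let $\mu\in\mathcal T_{d,k}$ and let $X_1,\dots,X_n\sim\mu$ be i.i.d. Then every $\nu\in\mathcal H$ has a continuous $\nu_0$-density $f_\nu$ on $\Omega_d$ which is positive and for which $\log f_\nu$ is $\mu$-integrable. The generalization error $$\varepsilon_{\mathrm{gen}}(n)=\sup_{\nu\in\mathcal H}\Big|\,\mathbb E_{X\sim\mu}[-\log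 f_\nu(X)]+\frac1n\sum_{i=1}^n\log f_\nu(X_i)\Big|$$ is measurable (up to modification on a null set), and $$\mathbb E[\varepsilon_{\mathrm{gen}}(n)]\le 48\,L\,W^2\,\frac{\Lambda_Z}{\sqrt n}.$$ -/

import Mathlib

open MeasureTheory ProbabilityTheory Set
open scoped ENNReal NNReal Matrix

namespace NeuralFlow

/-- `ℝ^d` with the Euclidean norm. -/
abbrev Vec (d : ℕ) : Type := EuclideanSpace ℝ (Fin d)

/-- The open Euclidean ball `Ω_d` of radius `1/2` around the origin. -/
def dom (d : ℕ) : Set (Vec d) := Metric.ball 0 (1 / 2)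

/-- The uniform distribution `ν₀` on `Ω_d`. -/
noncomputable def unif (d : ℕ) : Measure (Vec d) := ProbabilityTheory.cond volume (dom d)

/-- The Borel probability measures on `Ω_d`, seen as measures on `ℝ^d` that are carried by `Ω_d`. -/
def probOn (d : ℕ) : Set (Measure (Vec d)) := {μ | IsProbabilityMeasure μ ∧ μ (dom d)ᶜ = 0}

/-- The Hölder class `C^{k,α}(Ω_d)`: all derivatives up to order `k` exist, are continuous and
bounded, and those of order `k` are `α`-Hölder. -/
def IsHolder (d k : ℕ) (α : ℝ≥0) (f : Vec d → ℝ) : Prop :=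
  ContDiffOn ℝ k f (dom d) ∧
  (∀ j ≤ k, ∃ C : ℝ, ∀ x ∈ dom d, ‖iteratedFDerivWithin ℝ j f (dom d) x‖ ≤ C) ∧
  ∃ C : ℝ≥0, HolderOnWith C α (iteratedFDerivWithin ℝ k f (dom d)) (dom d)

/-- The target space `T_{d,k}`: probability measures on `Ω_d` with a positive `ν₀`-density of class
`C^{k,α}` for some `α ∈ (0,1]`. -/
def target (d k : ℕ) : Set (Measure (Vec d)) :=
  {μ | μ ∈ probOn d ∧ ∃ α : ℝ≥0, 0 < α ∧ α ≤ 1 ∧ ∃ f : Vec d → ℝ,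
    IsHolder d k α f ∧ (∀ x ∈ dom d, 0 < f x) ∧
    μ = (unif d).withDensity (fun x => ENNReal.ofReal (f x))}

/-- The rectified quadratic unit. -/
def requ (x : ℝ) : ℝ := (max x 0) ^ 2

/-- A layer `y ↦ σ (w y + b)`, with `σ` applied to each component. -/
def layer (σ : ℝ → ℝ) {l m : ℕ} (w : Matrix (Fin m) (Fin l) ℝ) (b : Fin m → ℝ)
    (y : Fin l → ℝ) : Fin m → ℝ :=
  fun i => σ ((w *ᵥ y + b) i)

/-- The layer sizes: the input `(y, t)` has size `d + 1`, and `ℓ i` is the size of the `(i+1)`-st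
hidden layer. -/
def size (d : ℕ) (ℓ : ℕ → ℕ) : ℕ → ℕ
  | 0 => d + 1
  | i + 1 => ℓ i

/-- The parameters `θ` of a network of depth `L` with input size `d + 1`, hidden widths
`ℓ 0, …, ℓ (L - 2)` and output size `d`. Only the hidden weights and biases with index
`i < L - 1` enter the network. -/
structure Params (d L : ℕ) (ℓ : ℕ → ℕ) where
  weight : ∀ i : ℕ, Matrix (Fin (ℓ i)) (Fin (size d ℓ i)) ℝ
  bias : ∀ i : ℕ, Fin (ℓ i) → ℝ
  out : Matrix (Fin d) (Fin (size d ℓ (L - 1))) ℝ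

/-- All weights and biases lie in `[-1, 1]`. -/
def Params.InCube {d L : ℕ} {ℓ : ℕ → ℕ} (θ : Params d L ℓ) : Prop :=
  (∀ i j k, θ.weight i j k ∈ Icc (-1 : ℝ) 1) ∧ (∀ i j, θ.bias i j ∈ Icc (-1 : ℝ) 1) ∧
  ∀ j k, θ.out j k ∈ Icc (-1 : ℝ) 1

/-- The output of the first `i` layers (all with `requ` activation). -/
def Params.hidden {d L : ℕ} {ℓ : ℕ → ℕ} (θ : Params d L ℓ) (z : Fin (d + 1) → ℝ) :
    (i : ℕ) → Fin (size d ℓ i) → ℝ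
  | 0 => z
  | i + 1 => layer requ (θ.weight i) (θ.bias i) (θ.hidden z i)

/-- The time-dependent vector field `η_θ (y, t)` of the network: `L - 1` layers with `requ`
activation, followed by a linear layer without bias. -/
noncomputable def Params.field {d L : ℕ} {ℓ : ℕ → ℕ} (θ : Params d L ℓ) (y : Vec d) (t : ℝ) :
    Vec d :=
  WithLp.toLp 2 (layer id θ.out 0 (θ.hidden (Fin.snoc (α := fun _ => ℝ) (fun i => y i) t) (L - 1)))

/-- The vector fields in the network class `NN(L, W)`: depth `L`, layer widths at most `W` (the
output width `d` is one of them), weights and biases in `[-1, 1]`. -/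
def netClass (d L W : ℕ) : Set (Vec d → ℝ → Vec d) :=
  {η | d ≤ W ∧ ∃ ℓ : ℕ → ℕ, (∀ i, ℓ i ≤ W) ∧ ∃ θ : Params d L ℓ, θ.InCube ∧ η = θ.field}

/-- One step, from time `t` to `t + h`, of the explicit Runge-Kutta method of order two. -/
noncomputable def rkStep {d : ℕ} (h : ℝ) (η : Vec d → ℝ → Vec d) (t : ℝ) (y : Vec d) : Vec d :=
  y + h • η (y + (h / 2) • η y t) (t + h / 2)

/-- `k` Runge-Kutta steps of size `h`, started at time `0`. -/
noncomputable def rkIter {d : ℕ} (h : ℝ) (η : Vec d → ℝ → Vec d) : ℕ → Vec d → Vec d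
  | 0 => id
  | k + 1 => rkStep h η (k * h) ∘ rkIter h η k

/-- The discretized flow endpoint `Ψ^h(η)` at time `1`, with `m` steps of size `h = 1/m`. -/
noncomputable def rkFlow {d : ℕ} (m : ℕ) (η : Vec d → ℝ → Vec d) : Vec d → Vec d :=
  rkIter (1 / m) η m

/-- The hypothesis space `H^h_{L,W}`, `h = 1/m`: the probability measures `(Ψ^h(η))⁻¹_* ν₀` on
`Ω_d`, for the networks `η ∈ NN(L, W)` each of whose Runge-Kutta steps is a bijection of `Ω_d`. -/
def hypSpace (d L W m : ℕ) : Set (Measure (Vec d)) :=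
  {ν | ν ∈ probOn d ∧ ∃ η ∈ netClass d L W,
    (∀ k < m, BijOn (rkStep (1 / m) η (k * (1 / m))) (dom d) (dom d)) ∧
    ν = (unif d).map (Function.invFunOn (rkFlow m η) (dom d))}

/-- `f` is a continuous version on `Ω_d` of the `ν₀`-density of `ν` (it is unique on `Ω_d`). -/
def IsContDensity {d : ℕ} (ν : Measure (Vec d)) (f : Vec d → ℝ) : Prop :=
  ContinuousOn f (dom d) ∧ (∀ x ∈ dom d, 0 ≤ f x) ∧
  ν = (unif d).withDensity (fun x => ENNReal.ofReal (f x))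

open Classical in
/-- The `ν₀`-density `f_ν` of `ν`: the continuous version where there is one. -/
noncomputable def density {d : ℕ} (ν : Measure (Vec d)) : Vec d → ℝ :=
  if h : ∃ f, IsContDensity ν f then h.choose else fun x => (ν.rnDeriv (unif d) x).toReal

/-- The expected negative log-likelihood of `ν` under `μ`. -/
noncomputable def risk {d : ℕ} (μ ν : Measure (Vec d)) : ℝ :=
  ∫ x, -Real.log (density ν x) ∂μ

/-- The empirical risk of `ν` on the sample `x`: the mean negative log-likelihood. -/
noncomputable def empRisk {d n : ℕ} (ν : Measure (Vec d)) (x : Fin n → Vec d) : ℝ :=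
  (1 / n : ℝ) * ∑ i, -Real.log (density ν (x i))

/-- The generalization error: the supremum over `H` of `|risk - empirical risk|`, in `[0, ∞]`. -/
noncomputable def genError {d n : ℕ} (μ : Measure (Vec d)) (H : Set (Measure (Vec d)))
    (x : Fin n → Vec d) : ℝ≥0∞ :=
  ⨆ ν ∈ H, ENNReal.ofReal |risk μ ν - empRisk ν x|

/-- The radii `R_ℓ`: `R_0 = sup {‖z‖ : z ∈ Ω_d × [0,1]}` and `R_{ℓ+1} = (2W)² R_ℓ²`. -/
noncomputable def radius (W : ℕ) : ℕ → ℝ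
  | 0 => Real.sqrt (1 + 1 / 4)
  | l + 1 => (2 * W) ^ 2 * radius W l ^ 2

/-- `Λ = ((2W)² R_{L-1})^L`. -/
noncomputable def lam (L W : ℕ) : ℝ := ((2 * W) ^ 2 * radius W (L - 1)) ^ L

/-- `Λ_Z = (8 d Λ⁵ e^Λ)^d`. -/
noncomputable def lamZ (d L W : ℕ) : ℝ := (8 * d * lam L W ^ 5 * Real.exp (lam L W)) ^ d

end NeuralFlow

/-! Pulling `unif d` back along the discretized flow gives a measure whose density is the absolute
Jacobian of the flow (`FieldBound.isContDensity_logJac`). By the chain rule, its logarithm is a sum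
of terms `log |det (1 + h • slope)|` along the trajectory, one per Runge-Kutta step. The step-size
condition keeps each `h • slope` of norm at most `1/4`, where `log |det (1 + ·)|` is Lipschitz.
Every summand then carries a factor `h`, and `m * h ≤ 1`, so all bounds are independent of `m`.

Two estimates follow, both with constant `lamZ / 4`. The log-density is bounded on the domain, and
it is Lipschitz in the weights and biases for the sup norm. For the latter, induction over the
layers (`GrowthBound.fieldClose`) shows that the vector field and its spatial derivative depend on
the parameters in a Lipschitz way. A discrete Grönwall argument carries this over to trajectories
(`FieldClose.norm_rkIter_sub_le`) and then to log-Jacobians (`FieldClose.abs_logJac_sub_le`).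

After padding with zeros, a network is a point of a cube of dimension `N = L * W * (W + 2) ≤ 3 * L *
W ^ 2`. The generalization error is thus the supremum of an empirical process indexed by a subset of
this cube. Dyadic chaining with Hoeffding's lemma (`lintegral_iSup_deviation_le`) bounds its mean by
`N * (4 * B + 14 * K) / √n`, with `B = K = lamZ / 4`. Not every point of the cube is admissible,
since the steps must preserve the ball; the chaining therefore uses only representatives taken from
the class itself. -/

namespace NeuralFlow

/-! ### Logarithms of determinants near the identity. -/

section LogDet

variable {E : Type*} [NormedAddCommGroup E] [NormedSpace ℝ E] [FiniteDimensional ℝ E]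

/-- The image of the unit ball lies in the ball of radius `‖T‖`; comparing Haar measures gives the
bound without any choice of basis. -/
lemma abs_det_le_norm_pow (T : E →L[ℝ] E) : |T.det| ≤ ‖T‖ ^ Module.finrank ℝ E := by
  borelize E
  let μ : Measure E := Measure.addHaar
  have h1 := Measure.addHaar_image_continuousLinearMap μ T (Metric.ball 0 1)
  have h2 : T '' Metric.ball 0 1 ⊆ Metric.closedBall 0 ‖T‖ := by
    rintro _ ⟨x, hx, rfl⟩
    rw [mem_closedBall_zero_iff]
    have hx' : ‖x‖ ≤ 1 := (mem_ball_zero_iff.mp hx).le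
    calc ‖T x‖ ≤ ‖T‖ * ‖x‖ := T.le_opNorm x
      _ ≤ ‖T‖ := mul_le_of_le_one_right (norm_nonneg _) hx'
  have h3 := measure_mono (μ := μ) h2
  rw [h1, Measure.addHaar_closedBall μ 0 (norm_nonneg T)] at h3
  have h4 : μ (Metric.ball 0 1) ≠ 0 := (Metric.measure_ball_pos μ 0 one_pos).ne'
  have h5 : μ (Metric.ball 0 1) ≠ ∞ := measure_ball_lt_top.ne
  rw [ENNReal.mul_le_mul_iff_left h4 h5,
    ENNReal.ofReal_le_ofReal_iff (pow_nonneg (norm_nonneg _) _)] at h3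
  exact h3

lemma norm_one_clm_le {E : Type*} [NormedAddCommGroup E] [NormedSpace ℝ E] :
    ‖(1 : E →L[ℝ] E)‖ ≤ 1 := ContinuousLinearMap.norm_id_le

lemma exists_inverse_one_add {B : E →L[ℝ] E} (hB : ‖B‖ ≤ 1 / 4) :
    ∃ C : E →L[ℝ] E, (1 + B) * C = 1 ∧ ‖C‖ ≤ 4 / 3 := by
  have hB' : ‖-B‖ < 1 := by rw [norm_neg]; linarith
  let u := Units.oneSub (-B) hB'
  have hu : (u : E →L[ℝ] E) = 1 + B := by simp [u]
  refine ⟨↑u⁻¹, by rw [← hu]; exact u.mul_inv, ?_⟩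
  -- With `C` the inverse, `C = 1 - B * C` gives `‖C‖ ≤ 1 + ‖C‖ / 4`, hence `‖C‖ ≤ 4 / 3`.
  have h1 : ((u⁻¹ : (E →L[ℝ] E)ˣ) : E →L[ℝ] E) = 1 - B * ↑u⁻¹ := by
    have := u.mul_inv
    rw [hu, add_mul, one_mul] at this
    exact eq_sub_of_add_eq this
  have h2 : ‖((u⁻¹ : (E →L[ℝ] E)ˣ) : E →L[ℝ] E)‖ ≤
      1 + 1 / 4 * ‖((u⁻¹ : (E →L[ℝ] E)ˣ) : E →L[ℝ] E)‖ := by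
    calc ‖((u⁻¹ : (E →L[ℝ] E)ˣ) : E →L[ℝ] E)‖ = ‖1 - B * ↑u⁻¹‖ := by rw [← h1]
      _ ≤ ‖(1 : E →L[ℝ] E)‖ + ‖B * ↑u⁻¹‖ := norm_sub_le _ _
      _ ≤ 1 + ‖B‖ * ‖((u⁻¹ : (E →L[ℝ] E)ˣ) : E →L[ℝ] E)‖ :=
        add_le_add norm_one_clm_le (norm_mul_le _ _)
      _ ≤ _ := by gcongr
  linarith

lemma det_mul_clm {E : Type*} [NormedAddCommGroup E] [NormedSpace ℝ E] (S T : E →L[ℝ] E) : (S * T).det = S.det * T.det := by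
  simp only [ContinuousLinearMap.det, ContinuousLinearMap.toLinearMap_mul, LinearMap.det_comp,
    Module.End.mul_eq_comp]

lemma det_one_add_ne_zero {B : E →L[ℝ] E} (hB : ‖B‖ ≤ 1 / 4) : (1 + B).det ≠ 0 := by
  obtain ⟨C, hC, -⟩ := exists_inverse_one_add hB
  intro h0
  have := congrArg ContinuousLinearMap.det hC
  rw [det_mul_clm, h0, zero_mul] at this
  simp [ContinuousLinearMap.det] at this

/-- Factoring `1 + A = (1 + B) * (1 + C * (A - B))`, with `C` the inverse of `1 + B`, turns the
difference of logarithms into the logarithm of one determinant, which the operator norm controls.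
Since `Real.log` is even, the signs of the determinants play no role. -/
lemma log_abs_det_sub_le {A B : E →L[ℝ] E} (hA : ‖A‖ ≤ 1 / 4) (hB : ‖B‖ ≤ 1 / 4) :
    Real.log (1 + A).det - Real.log (1 + B).det ≤
      Module.finrank ℝ E * (4 / 3 * ‖A - B‖) := by
  obtain ⟨C, hC, hCn⟩ := exists_inverse_one_add hB
  have hfac : 1 + A = (1 + B) * (1 + C * (A - B)) := by
    rw [mul_add, ← mul_assoc, hC]; simp
  have hA0 := det_one_add_ne_zero hA
  have hB0 := det_one_add_ne_zero hB
  have hX0 : (1 + C * (A - B)).det ≠ 0 := by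
    intro h0
    rw [hfac, det_mul_clm, h0, mul_zero] at hA0
    exact hA0 rfl
  rw [hfac, det_mul_clm, Real.log_mul hB0 hX0, add_sub_cancel_left, ← Real.log_abs]
  have hXn : ‖1 + C * (A - B)‖ ≤ 1 + 4 / 3 * ‖A - B‖ := by
    refine (norm_add_le _ _).trans (add_le_add norm_one_clm_le ((norm_mul_le _ _).trans ?_))
    gcongr
  have hexp : ‖1 + C * (A - B)‖ ≤ Real.exp (4 / 3 * ‖A - B‖) :=
    hXn.trans (by linarith [Real.add_one_le_exp (4 / 3 * ‖A - B‖)])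
  calc Real.log |(1 + C * (A - B)).det|
      ≤ Real.log (Real.exp (4 / 3 * ‖A - B‖) ^ Module.finrank ℝ E) := by
        apply Real.log_le_log (abs_pos.mpr hX0)
        exact (abs_det_le_norm_pow _).trans (by gcongr)
    _ = _ := by rw [Real.log_pow, Real.log_exp]

lemma abs_log_abs_det_sub_le {A B : E →L[ℝ] E} (hA : ‖A‖ ≤ 1 / 4) (hB : ‖B‖ ≤ 1 / 4) :
    |Real.log (1 + A).det - Real.log (1 + B).det| ≤
      Module.finrank ℝ E * (4 / 3 * ‖A - B‖) := by
  rw [abs_sub_le_iff]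
  exact ⟨log_abs_det_sub_le hA hB, by rw [norm_sub_rev]; exact log_abs_det_sub_le hB hA⟩

lemma abs_log_abs_det_le {A : E →L[ℝ] E} (hA : ‖A‖ ≤ 1 / 4) :
    |Real.log (1 + A).det| ≤ Module.finrank ℝ E * (4 / 3 * ‖A‖) := by
  have := abs_log_abs_det_sub_le hA (B := 0) (by simp)
  simpa [ContinuousLinearMap.det] using this

end LogDet

/-! ### Stability of the Runge-Kutta flow and of its Jacobian. -/

section RungeKutta

variable {d : ℕ}

/-- `D` is the spatial derivative of `η`, and `S`, `G` bound `η` and `D` on the unit ball. -/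
structure FieldBound (η : Vec d → ℝ → Vec d) (D : Vec d → ℝ → Vec d →L[ℝ] Vec d) (S G : ℝ) :
    Prop where
  hasFDerivAt : ∀ y t, HasFDerivAt (fun x => η x t) (D y t) y
  continuous_deriv : ∀ t, Continuous fun x => D x t
  norm_le : ∀ y t, ‖y‖ ≤ 1 → t ∈ Icc (0 : ℝ) 1 → ‖η y t‖ ≤ S
  norm_deriv_le : ∀ y t, ‖y‖ ≤ 1 → t ∈ Icc (0 : ℝ) 1 → ‖D y t‖ ≤ G

/-- Two fields and their derivatives are close on the unit ball, up to Lipschitz errors. -/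
structure FieldClose (η : Vec d → ℝ → Vec d) (D : Vec d → ℝ → Vec d →L[ℝ] Vec d)
    (η' : Vec d → ℝ → Vec d) (D' : Vec d → ℝ → Vec d →L[ℝ] Vec d) (G G₂ e₀ e₁ : ℝ) : Prop where
  norm_sub_le : ∀ y y' t, ‖y‖ ≤ 1 → ‖y'‖ ≤ 1 → t ∈ Icc (0 : ℝ) 1 →
    ‖η y t - η' y' t‖ ≤ G * ‖y - y'‖ + e₀
  norm_deriv_sub_le : ∀ y y' t, ‖y‖ ≤ 1 → ‖y'‖ ≤ 1 → t ∈ Icc (0 : ℝ) 1 →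
    ‖D y t - D' y' t‖ ≤ G₂ * ‖y - y'‖ + e₁

/-- The step-size conditions under which one Runge-Kutta step is a small perturbation of the
identity. -/
structure StepBound (h S G : ℝ) : Prop where
  nonneg : 0 ≤ h
  le_one : h ≤ 1
  mul_le : h * S ≤ 1 / 4
  mul_le' : h * G ≤ 1 / 8
  G_nonneg : 0 ≤ G

/-- The intermediate point of a Runge-Kutta step. -/
noncomputable def rkMid (h : ℝ) (η : Vec d → ℝ → Vec d) (t : ℝ) (y : Vec d) : Vec d :=
  y + (h / 2) • η y t

/-- The derivative of a Runge-Kutta step is `1 + h • rkSlope`. -/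
noncomputable def rkSlope (h : ℝ) (η : Vec d → ℝ → Vec d) (D : Vec d → ℝ → Vec d →L[ℝ] Vec d)
    (t : ℝ) (y : Vec d) : Vec d →L[ℝ] Vec d :=
  D (rkMid h η t y) (t + h / 2) * (1 + (h / 2) • D y t)

/-- The logarithm of the Jacobian of `k` Runge-Kutta steps. -/
noncomputable def logJac (h : ℝ) (η : Vec d → ℝ → Vec d) (D : Vec d → ℝ → Vec d →L[ℝ] Vec d)
    (k : ℕ) (x : Vec d) : ℝ :=
  ∑ j ∈ Finset.range k, Real.log (1 + h • rkSlope h η D (j * h) (rkIter h η j x)).det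

variable {η η' : Vec d → ℝ → Vec d} {D D' : Vec d → ℝ → Vec d →L[ℝ] Vec d}
  {S G G₂ e₀ e₁ h t : ℝ}

lemma FieldBound.hasFDerivAt_rkStep (hη : FieldBound η D S G) (h t : ℝ) (y : Vec d) :
    HasFDerivAt (rkStep h η t) (1 + h • rkSlope h η D t y) y := by
  have h1 : HasFDerivAt (rkMid h η t) (1 + (h / 2) • D y t) y :=
    (hasFDerivAt_id y).add ((hη.hasFDerivAt y t).const_smul (h / 2))
  have h2 := (hη.hasFDerivAt (rkMid h η t y) (t + h / 2)).comp y h1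
  exact (hasFDerivAt_id y).add (h2.const_smul h)

/-- The intermediate point may leave the domain, but it stays in the unit ball. This is why the
field bounds are imposed there. -/
lemma FieldBound.norm_rkMid_le (hη : FieldBound η D S G) (hh : StepBound h S G)
    (ht : t ∈ Icc (0 : ℝ) 1) {y : Vec d} (hy : ‖y‖ ≤ 1 / 2) : ‖rkMid h η t y‖ ≤ 1 := by
  have h0 := hh.nonneg
  calc ‖rkMid h η t y‖ ≤ ‖y‖ + ‖(h / 2) • η y t‖ := norm_add_le _ _
    _ = ‖y‖ + h / 2 * ‖η y t‖ := by rw [norm_smul, Real.norm_of_nonneg (by positivity)]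
    _ ≤ 1 / 2 + h / 2 * S := by
      gcongr
      exact hη.norm_le y t (hy.trans (by norm_num)) ht
    _ ≤ 1 := by linarith [hh.mul_le]

lemma FieldBound.norm_factor_le (hη : FieldBound η D S G) (hh : StepBound h S G)
    (ht : t ∈ Icc (0 : ℝ) 1) {y : Vec d} (hy : ‖y‖ ≤ 1) :
    ‖1 + (h / 2) • D y t‖ ≤ 17 / 16 := by
  have h0 := hh.nonneg
  calc ‖1 + (h / 2) • D y t‖ ≤ ‖(1 : Vec d →L[ℝ] Vec d)‖ + ‖(h / 2) • D y t‖ := norm_add_le _ _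
    _ = ‖(1 : Vec d →L[ℝ] Vec d)‖ + h / 2 * ‖D y t‖ := by
      rw [norm_smul, Real.norm_of_nonneg (by positivity)]
    _ ≤ 1 + h / 2 * G := by
      gcongr
      exacts [norm_one_clm_le, hη.norm_deriv_le y t hy ht]
    _ ≤ 17 / 16 := by linarith [hh.mul_le']

lemma FieldBound.norm_rkSlope_le (hη : FieldBound η D S G) (hh : StepBound h S G)
    (ht : t ∈ Icc (0 : ℝ) 1) (ht' : t + h / 2 ∈ Icc (0 : ℝ) 1) {y : Vec d} (hy : ‖y‖ ≤ 1 / 2) :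
    ‖rkSlope h η D t y‖ ≤ G * (17 / 16) := by
  have hG := hh.G_nonneg
  refine (norm_mul_le _ _).trans ?_
  gcongr
  · exact hη.norm_deriv_le _ _ (hη.norm_rkMid_le hh ht hy) ht'
  · exact hη.norm_factor_le hh ht (hy.trans (by norm_num))

lemma FieldBound.norm_smul_rkSlope_le (hη : FieldBound η D S G) (hh : StepBound h S G)
    (ht : t ∈ Icc (0 : ℝ) 1) (ht' : t + h / 2 ∈ Icc (0 : ℝ) 1) {y : Vec d} (hy : ‖y‖ ≤ 1 / 2) :
    ‖h • rkSlope h η D t y‖ ≤ 1 / 4 := by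
  rw [norm_smul, Real.norm_of_nonneg hh.nonneg]
  have := mul_le_mul_of_nonneg_left (hη.norm_rkSlope_le hh ht ht' hy) hh.nonneg
  linarith [hh.mul_le']

lemma FieldClose.norm_rkMid_sub_le (hc : FieldClose η D η' D' G G₂ e₀ e₁)
    (hh : StepBound h S G) (ht : t ∈ Icc (0 : ℝ) 1) {y y' : Vec d} (hy : ‖y‖ ≤ 1)
    (hy' : ‖y'‖ ≤ 1) :
    ‖rkMid h η t y - rkMid h η' t y'‖ ≤ 17 / 16 * ‖y - y'‖ + h / 2 * e₀ := by
  have h0 := hh.nonneg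
  have h1 : rkMid h η t y - rkMid h η' t y' = (y - y') + (h / 2) • (η y t - η' y' t) := by
    simp only [rkMid, smul_sub]; abel
  rw [h1]
  calc ‖(y - y') + (h / 2) • (η y t - η' y' t)‖
      ≤ ‖y - y'‖ + h / 2 * ‖η y t - η' y' t‖ := by
        refine (norm_add_le _ _).trans_eq ?_
        rw [norm_smul, Real.norm_of_nonneg (by positivity)]
    _ ≤ ‖y - y'‖ + h / 2 * (G * ‖y - y'‖ + e₀) := by
        gcongr
        exact hc.norm_sub_le y y' t hy hy' ht
    _ ≤ _ := by
        have := mul_le_mul_of_nonneg_right hh.mul_le' (norm_nonneg (y - y'))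
        linarith

lemma FieldClose.norm_rkStep_sub_le (hc : FieldClose η D η' D' G G₂ e₀ e₁)
    (hη : FieldBound η D S G) (hη' : FieldBound η' D' S G) (hh : StepBound h S G) (he : 0 ≤ e₀)
    (ht : t ∈ Icc (0 : ℝ) 1) (ht' : t + h / 2 ∈ Icc (0 : ℝ) 1) {y y' : Vec d}
    (hy : ‖y‖ ≤ 1 / 2) (hy' : ‖y'‖ ≤ 1 / 2) :
    ‖rkStep h η t y - rkStep h η' t y'‖ ≤ (1 + 2 * (h * G)) * ‖y - y'‖ + 2 * h * e₀ := by
  have h0 := hh.nonneg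
  have hG := hh.G_nonneg
  have h1 : rkStep h η t y - rkStep h η' t y' = (y - y') +
      h • (η (rkMid h η t y) (t + h / 2) - η' (rkMid h η' t y') (t + h / 2)) := by
    simp only [rkStep, rkMid, smul_sub]; abel
  rw [h1]
  calc _ ≤ ‖y - y'‖ +
        h * ‖η (rkMid h η t y) (t + h / 2) - η' (rkMid h η' t y') (t + h / 2)‖ := by
        refine (norm_add_le _ _).trans_eq ?_
        rw [norm_smul, Real.norm_of_nonneg h0]
    _ ≤ ‖y - y'‖ + h * (G * (17 / 16 * ‖y - y'‖ + h / 2 * e₀) + e₀) := by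
        gcongr
        refine (hc.norm_sub_le _ _ _ (hη.norm_rkMid_le hh ht hy)
          (hη'.norm_rkMid_le hh ht hy') ht').trans ?_
        gcongr
        exact hc.norm_rkMid_sub_le hh ht (hy.trans (by norm_num)) (hy'.trans (by norm_num))
    _ ≤ _ := by
        have h2 := mul_le_mul_of_nonneg_right hh.mul_le' (mul_nonneg h0 he)
        have h3 : 0 ≤ h * G * ‖y - y'‖ := by positivity
        have h4 : 0 ≤ h * e₀ := by positivity
        nlinarith

lemma FieldClose.norm_rkSlope_sub_le (hc : FieldClose η D η' D' G G₂ e₀ e₁)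
    (hη : FieldBound η D S G) (hη' : FieldBound η' D' S G) (hh : StepBound h S G) (he : 0 ≤ e₀)
    (he₁ : 0 ≤ e₁) (hG₂ : 0 ≤ G₂)
    (ht : t ∈ Icc (0 : ℝ) 1) (ht' : t + h / 2 ∈ Icc (0 : ℝ) 1) {y y' : Vec d}
    (hy : ‖y‖ ≤ 1 / 2) (hy' : ‖y'‖ ≤ 1 / 2) :
    ‖rkSlope h η D t y - rkSlope h η' D' t y'‖ ≤ 2 * (G₂ * (2 * ‖y - y'‖ + e₀) + e₁) := by
  have h0 := hh.nonneg
  have hG := hh.G_nonneg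
  have hy1 : ‖y‖ ≤ 1 := hy.trans (by norm_num)
  have hy1' : ‖y'‖ ≤ 1 := hy'.trans (by norm_num)
  have h1 : rkSlope h η D t y - rkSlope h η' D' t y' =
      (D (rkMid h η t y) (t + h / 2) - D' (rkMid h η' t y') (t + h / 2)) *
        (1 + (h / 2) • D y t) +
      D' (rkMid h η' t y') (t + h / 2) * ((h / 2) • (D y t - D' y' t)) := by
    simp only [rkSlope, mul_add, sub_mul, smul_sub, mul_sub]; abel
  have h2 : ‖D (rkMid h η t y) (t + h / 2) - D' (rkMid h η' t y') (t + h / 2)‖ ≤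
      G₂ * (2 * ‖y - y'‖ + e₀) + e₁ := by
    refine (hc.norm_deriv_sub_le _ _ _ (hη.norm_rkMid_le hh ht hy)
          (hη'.norm_rkMid_le hh ht hy') ht').trans ?_
    gcongr
    refine (hc.norm_rkMid_sub_le hh ht hy1 hy1').trans ?_
    have : h * e₀ ≤ e₀ := mul_le_of_le_one_left he hh.le_one
    linarith [norm_nonneg (y - y')]
  have h3 : ‖D' (rkMid h η' t y') (t + h / 2) * ((h / 2) • (D y t - D' y' t))‖ ≤
      1 / 16 * (G₂ * (2 * ‖y - y'‖ + e₀) + e₁) := by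
    refine (norm_mul_le _ _).trans ?_
    rw [norm_smul, Real.norm_of_nonneg (by positivity)]
    calc _ ≤ G * (h / 2 * (G₂ * ‖y - y'‖ + e₁)) := by
          gcongr
          · exact hη'.norm_deriv_le _ _ (hη'.norm_rkMid_le hh ht hy') ht'
          · exact hc.norm_deriv_sub_le _ _ _ hy1 hy1' ht
      _ = h * G * (1 / 2 * (G₂ * ‖y - y'‖ + e₁)) := by ring
      _ ≤ 1 / 8 * (1 / 2 * (G₂ * (2 * ‖y - y'‖ + e₀) + e₁)) := by
          gcongr
          · exact hh.mul_le'
          · linarith [norm_nonneg (y - y')]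
      _ = _ := by ring
  rw [h1]
  refine (norm_add_le _ _).trans ?_
  have h5 : ‖(D (rkMid h η t y) (t + h / 2) - D' (rkMid h η' t y') (t + h / 2)) *
        (1 + (h / 2) • D y t)‖ ≤ (G₂ * (2 * ‖y - y'‖ + e₀) + e₁) * (17 / 16) := by
    refine (norm_mul_le _ _).trans ?_
    gcongr
    exact hη.norm_factor_le hh ht hy1
  have h6 : 0 ≤ G₂ * (2 * ‖y - y'‖ + e₀) + e₁ := by positivity
  linarith

/-- All steps of the discretized flow map the domain to itself. -/
def StepsMapTo (h : ℝ) (η : Vec d → ℝ → Vec d) (m : ℕ) : Prop :=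
  ∀ k < m, MapsTo (rkStep h η (k * h)) (dom d) (dom d)

lemma StepsMapTo.rkIter_mem {m : ℕ} (hs : StepsMapTo h η m) {x : Vec d} (hx : x ∈ dom d) :
    ∀ k ≤ m, rkIter h η k x ∈ dom d
  | 0, _ => hx
  | k + 1, hk => hs k hk (hs.rkIter_mem hx k (by omega))

lemma norm_le_of_mem_dom {x : Vec d} (hx : x ∈ dom d) : ‖x‖ ≤ 1 / 2 :=
  (mem_ball_zero_iff.mp hx).le

lemma StepBound.time_mem {m k : ℕ} (hh : StepBound h S G) (hm : m * h ≤ 1) (hk : k < m) :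
    (k * h : ℝ) ∈ Icc (0 : ℝ) 1 ∧ (k * h + h / 2 : ℝ) ∈ Icc (0 : ℝ) 1 := by
  have h0 := hh.nonneg
  have h1 : ((k : ℝ) + 1) * h ≤ m * h := by
    gcongr; exact_mod_cast hk
  refine ⟨⟨by positivity, by nlinarith⟩, ⟨by positivity, by nlinarith⟩⟩

/-- Discrete Grönwall: a step multiplies the gap between the two trajectories by at most `1 + 2 * h
* G ≤ exp (2 * h * G)` and adds at most `2 * h * e₀`. -/
lemma FieldClose.norm_rkIter_sub_le (hc : FieldClose η D η' D' G G₂ e₀ e₁)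
    (hη : FieldBound η D S G) (hη' : FieldBound η' D' S G) (hh : StepBound h S G) (he : 0 ≤ e₀)
    {m : ℕ} (hm : m * h ≤ 1) (hs : StepsMapTo h η m) (hs' : StepsMapTo h η' m) {x : Vec d}
    (hx : x ∈ dom d) : ∀ k ≤ m, ‖rkIter h η k x - rkIter h η' k x‖ ≤
      k * (2 * h * e₀) * Real.exp (k * (2 * (h * G)))
  | 0, _ => by simp [rkIter]
  | k + 1, hk => by
    have h0 := hh.nonneg
    have hG := hh.G_nonneg
    have ih := hc.norm_rkIter_sub_le hη hη' hh he hm hs hs' hx k (by omega)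
    obtain ⟨ht, ht'⟩ := hh.time_mem hm (Nat.lt_of_succ_le hk)
    have h1 := hc.norm_rkStep_sub_le hη hη' hh he ht ht'
      (norm_le_of_mem_dom (hs.rkIter_mem hx k (by omega)))
      (norm_le_of_mem_dom (hs'.rkIter_mem hx k (by omega)))
    have h2 : 1 + 2 * (h * G) ≤ Real.exp (2 * (h * G)) := by
      linarith [Real.add_one_le_exp (2 * (h * G))]
    have h3 : Real.exp (((k + 1 : ℕ) : ℝ) * (2 * (h * G))) =
        Real.exp (2 * (h * G)) * Real.exp (k * (2 * (h * G))) := by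
      rw [← Real.exp_add]; congr 1; push_cast; ring
    have h4 : 1 ≤ Real.exp (((k + 1 : ℕ) : ℝ) * (2 * (h * G))) :=
      Real.one_le_exp (by positivity)
    calc ‖rkIter h η (k + 1) x - rkIter h η' (k + 1) x‖
        ≤ (1 + 2 * (h * G)) * ‖rkIter h η k x - rkIter h η' k x‖ + 2 * h * e₀ := h1
      _ ≤ Real.exp (2 * (h * G)) * (k * (2 * h * e₀) * Real.exp (k * (2 * (h * G)))) +
          2 * h * e₀ * Real.exp (((k + 1 : ℕ) : ℝ) * (2 * (h * G))) := by
          refine add_le_add (mul_le_mul h2 ih (norm_nonneg _) (Real.exp_pos _).le) ?_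
          exact le_mul_of_one_le_right (by positivity : 0 ≤ 2 * h * e₀) h4
      _ = _ := by rw [h3]; push_cast; ring

lemma FieldClose.abs_logJac_sub_le (hc : FieldClose η D η' D' G G₂ e₀ e₁)
    (hη : FieldBound η D S G) (hη' : FieldBound η' D' S G) (hh : StepBound h S G) (he : 0 ≤ e₀)
    (he₁ : 0 ≤ e₁) (hG₂ : 0 ≤ G₂)
    {m : ℕ} (hm : m * h ≤ 1) (hs : StepsMapTo h η m) (hs' : StepsMapTo h η' m) {x : Vec d}
    (hx : x ∈ dom d) :
    |logJac h η D m x - logJac h η' D' m x| ≤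
      d * (8 / 3) * (G₂ * (5 * e₀ * Real.exp (2 * G)) + e₁) := by
  have h0 := hh.nonneg
  have hG := hh.G_nonneg
  have hE : 1 ≤ Real.exp (2 * G) := Real.one_le_exp (by positivity)
  rw [logJac, logJac, ← Finset.sum_sub_distrib]
  refine (Finset.abs_sum_le_sum_abs _ _).trans ?_
  have key : ∀ j ∈ Finset.range m,
      |Real.log (1 + h • rkSlope h η D (j * h) (rkIter h η j x)).det -
        Real.log (1 + h • rkSlope h η' D' (j * h) (rkIter h η' j x)).det| ≤
      h * (d * (8 / 3) * (G₂ * (5 * e₀ * Real.exp (2 * G)) + e₁)) := by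
    intro j hj
    have hjm := Finset.mem_range.mp hj
    obtain ⟨ht, ht'⟩ := hh.time_mem hm hjm
    have hy := norm_le_of_mem_dom (hs.rkIter_mem hx j hjm.le)
    have hy' := norm_le_of_mem_dom (hs'.rkIter_mem hx j hjm.le)
    refine (abs_log_abs_det_sub_le (hη.norm_smul_rkSlope_le hh ht ht' hy)
      (hη'.norm_smul_rkSlope_le hh ht ht' hy')).trans ?_
    -- The elapsed time `j * h` is at most `1`, which removes the number of steps from the Grönwall
    -- bound.
    have hu : ‖rkIter h η j x - rkIter h η' j x‖ ≤ 2 * e₀ * Real.exp (2 * G) := by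
      refine (hc.norm_rkIter_sub_le hη hη' hh he hm hs hs' hx j hjm.le).trans ?_
      have hj1 := ht.2
      have h5 : j * (2 * h * e₀) ≤ 2 * e₀ := by nlinarith
      have h6 : j * (2 * (h * G)) ≤ 2 * G := by nlinarith
      gcongr
    rw [← smul_sub, norm_smul, Real.norm_of_nonneg h0, finrank_euclideanSpace_fin]
    have h7 := hc.norm_rkSlope_sub_le hη hη' hh he he₁ hG₂ ht ht' hy hy'
    have h8 : e₀ ≤ e₀ * Real.exp (2 * G) := le_mul_of_one_le_right he hE
    calc (d : ℝ) * (4 / 3 * (h * _))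
        ≤ d * (4 / 3 * (h * (2 * (G₂ * (2 * (2 * e₀ * Real.exp (2 * G)) +
            e₀ * Real.exp (2 * G)) + e₁)))) := by
          gcongr
          refine h7.trans ?_
          gcongr
      _ = _ := by ring
  refine (Finset.sum_le_sum key).trans ?_
  rw [Finset.sum_const, Finset.card_range, nsmul_eq_mul, ← mul_assoc]
  exact mul_le_of_le_one_left (by positivity) hm

lemma FieldBound.abs_logJac_le (hη : FieldBound η D S G) (hh : StepBound h S G)
    {m : ℕ} (hm : m * h ≤ 1) (hs : StepsMapTo h η m) {x : Vec d} (hx : x ∈ dom d) :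
    |logJac h η D m x| ≤ d * (2 * G) := by
  have h0 := hh.nonneg
  have hG := hh.G_nonneg
  refine (Finset.abs_sum_le_sum_abs _ _).trans ?_
  have key : ∀ j ∈ Finset.range m,
      |Real.log (1 + h • rkSlope h η D (j * h) (rkIter h η j x)).det| ≤ h * (d * (2 * G)) := by
    intro j hj
    have hjm := Finset.mem_range.mp hj
    obtain ⟨ht, ht'⟩ := hh.time_mem hm hjm
    have hy := norm_le_of_mem_dom (hs.rkIter_mem hx j hjm.le)
    refine (abs_log_abs_det_le (hη.norm_smul_rkSlope_le hh ht ht' hy)).trans ?_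
    rw [norm_smul, Real.norm_of_nonneg h0, finrank_euclideanSpace_fin]
    calc (d : ℝ) * (4 / 3 * (h * _)) ≤ d * (4 / 3 * (h * (G * (17 / 16)))) := by
          gcongr
          exact hη.norm_rkSlope_le hh ht ht' hy
      _ = h * (d * (17 / 12 * G)) := by ring
      _ ≤ _ := by gcongr; norm_num
  refine (Finset.sum_le_sum key).trans ?_
  rw [Finset.sum_const, Finset.card_range, nsmul_eq_mul, ← mul_assoc]
  exact mul_le_of_le_one_left (by positivity) hm

/-- Chain rule and multiplicativity of the determinant. The convention `Real.log x = log |x|` makes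
the exponential the absolute Jacobian, as the change of variables formula requires. -/
lemma FieldBound.exp_logJac (hη : FieldBound η D S G) (hh : StepBound h S G)
    {m : ℕ} (hm : m * h ≤ 1) (hs : StepsMapTo h η m) {x : Vec d} (hx : x ∈ dom d) :
    ∀ k ≤ m, ∃ T : Vec d →L[ℝ] Vec d, HasFDerivAt (rkIter h η k) T x ∧
      |T.det| = Real.exp (logJac h η D k x)
  | 0, _ => ⟨1, hasFDerivAt_id x, by simp [logJac, ContinuousLinearMap.det]⟩
  | k + 1, hk => by
    obtain ⟨T, hT, hTd⟩ := hη.exp_logJac hh hm hs hx k (by omega)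
    obtain ⟨ht, ht'⟩ := hh.time_mem hm (Nat.lt_of_succ_le hk)
    have hy := norm_le_of_mem_dom (hs.rkIter_mem hx k (by omega))
    refine ⟨(1 + h • rkSlope h η D (k * h) (rkIter h η k x)) * T,
      (hη.hasFDerivAt_rkStep h (k * h) (rkIter h η k x)).comp x hT, ?_⟩
    have hne := det_one_add_ne_zero (hη.norm_smul_rkSlope_le hh ht ht' hy)
    rw [det_mul_clm, abs_mul, hTd, logJac, logJac, Finset.sum_range_succ, Real.exp_add,
      ← Real.log_abs, Real.exp_log (abs_pos.mpr hne), mul_comm]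

end RungeKutta

/-! ### The ReQU activation: derivative and local Lipschitz bounds. -/

section Requ

/-- A quadratic Taylor remainder valid across the kink at `0`; it yields differentiability
everywhere without a case split. -/
lemma abs_requ_sub_sub_le (x y : ℝ) : |requ y - requ x - 2 * max x 0 * (y - x)| ≤ (y - x) ^ 2 := by
  unfold requ
  rw [abs_le]
  rcases le_total x 0 with hx | hx <;> rcases le_total y 0 with hy | hy <;>
    simp only [hx, hy, max_eq_left, max_eq_right] <;> constructor <;> nlinarith

lemma hasDerivAt_requ (x : ℝ) : HasDerivAt requ (2 * max x 0) x := by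
  rw [hasDerivAt_iff_isLittleO]
  refine Asymptotics.IsBigO.trans_isLittleO (g := fun y => (y - x) ^ 2) ?_ ?_
  · refine Asymptotics.isBigO_of_le _ fun y => ?_
    rw [Real.norm_eq_abs, Real.norm_eq_abs, abs_of_nonneg (sq_nonneg (y - x)), smul_eq_mul,
      mul_comm (y - x)]
    exact abs_requ_sub_sub_le x y
  · have := Asymptotics.isLittleO_pow_sub_sub x one_lt_two
    simpa only [Real.norm_eq_abs, sq_abs] using this

lemma requ_nonneg (x : ℝ) : 0 ≤ requ x := sq_nonneg _

lemma abs_max_zero_le (x : ℝ) : |max x 0| ≤ |x| := by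
  rw [abs_of_nonneg (le_max_right _ _)]
  exact max_le (le_abs_self x) (abs_nonneg x)

lemma requ_le {x c : ℝ} (hx : |x| ≤ c) : requ x ≤ c ^ 2 := by
  rw [requ, ← sq_abs (max x 0)]
  exact pow_le_pow_left₀ (abs_nonneg _) ((abs_max_zero_le x).trans hx) 2

lemma abs_max_sub_max_le (x y : ℝ) : |max x 0 - max y 0| ≤ |x - y| :=
  abs_max_sub_max_le_abs x y 0

lemma abs_requ_sub_le {x y c : ℝ} (hx : |x| ≤ c) (hy : |y| ≤ c) :
    |requ x - requ y| ≤ 2 * c * |x - y| := by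
  have h1 : requ x - requ y = (max x 0 + max y 0) * (max x 0 - max y 0) := by
    unfold requ; ring
  rw [h1, abs_mul]
  have h2 : |max x 0 + max y 0| ≤ 2 * c := by
    refine (abs_add_le _ _).trans ?_
    linarith [abs_max_zero_le x, abs_max_zero_le y]
  exact mul_le_mul h2 (abs_max_sub_max_le x y) (abs_nonneg _) ((abs_nonneg _).trans h2)

end Requ

/-! ### Layerwise growth and perturbation bounds for units and their tangents. -/

section Net

/-- Weights and biases of a network, indexed by layer, row and column. -/
structure Net where
  weight : ℕ → ℕ → ℕ → ℝ
  bias : ℕ → ℕ → ℝ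

/-- All entries are bounded by `1`. -/
def Net.IsBounded (N : Net) : Prop := (∀ l i k, |N.weight l i k| ≤ 1) ∧ ∀ l i, |N.bias l i| ≤ 1

/-- All entries of the two networks differ by at most `p`. -/
def Net.Within (N N' : Net) (p : ℝ) : Prop :=
  (∀ l i k, |N.weight l i k - N'.weight l i k| ≤ p) ∧ ∀ l i, |N.bias l i - N'.bias l i| ≤ p

/-- The number of inputs of layer `l`. -/
def fanIn (d W : ℕ) : ℕ → ℕ
  | 0 => d + 1
  | _ + 1 => W

variable (d W : ℕ)

/-- The values of the units of layer `l` on the input `z`. -/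
def Net.act (N : Net) (z : ℕ → ℝ) : ℕ → ℕ → ℝ
  | 0 => z
  | l + 1 => fun i =>
    requ (∑ k ∈ Finset.range (fanIn d W l), N.weight l i k * N.act z l k + N.bias l i)

/-- The values to which the activation function of layer `l + 1` is applied. -/
def Net.pre (N : Net) (z : ℕ → ℝ) (l i : ℕ) : ℝ :=
  ∑ k ∈ Finset.range (fanIn d W l), N.weight l i k * N.act d W z l k + N.bias l i

/-- The derivatives of the units of layer `l`, where `J` holds the derivatives of the inputs. -/
def Net.tan {V : Type*} [AddCommGroup V] [Module ℝ V] (N : Net) (z : ℕ → ℝ) (J : ℕ → V) :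
    ℕ → ℕ → V
  | 0 => J
  | l + 1 => fun i => (2 * max (N.pre d W z l i) 0) •
      ∑ k ∈ Finset.range (fanIn d W l), N.weight l i k • N.tan z J l k

/-- A bound for the sum of the units of layer `l`. -/
def actBound (W : ℕ) : ℕ → ℝ
  | 0 => 2 * W
  | l + 1 => W * (actBound W l + 1) ^ 2

lemma actBound_nonneg : ∀ l, 0 ≤ actBound W l
  | 0 => by unfold actBound; positivity
  | l + 1 => by unfold actBound; positivity

variable {d W} {V : Type*} [NormedAddCommGroup V] [NormedSpace ℝ V] {N N' : Net} {z z' : ℕ → ℝ}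
  {J : ℕ → V} {A p δ : ℝ} {M : ℕ}

lemma norm_sum_smul_le {c : ℕ → ℝ} {v : ℕ → V} {n : ℕ} (hc : ∀ k, |c k| ≤ p) {q : ℝ}
    (hp : 0 ≤ p) (hv : ∑ k ∈ Finset.range n, ‖v k‖ ≤ q) :
    ‖∑ k ∈ Finset.range n, c k • v k‖ ≤ p * q := by
  calc ‖∑ k ∈ Finset.range n, c k • v k‖ ≤ ∑ k ∈ Finset.range n, ‖c k • v k‖ := norm_sum_le _ _
    _ ≤ ∑ k ∈ Finset.range n, p * ‖v k‖ := by
      refine Finset.sum_le_sum fun k _ => ?_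
      rw [norm_smul, Real.norm_eq_abs]
      exact mul_le_mul_of_nonneg_right (hc k) (norm_nonneg _)
    _ ≤ p * q := by
      rw [← Finset.mul_sum]
      exact mul_le_mul_of_nonneg_left hv hp

lemma norm_sum_smul_sub_le {c c' : ℕ → ℝ} {v v' : ℕ → V} {n : ℕ} (hc' : ∀ k, |c' k| ≤ 1)
    (hcc : ∀ k, |c k - c' k| ≤ p) (hp : 0 ≤ p) {q e : ℝ}
    (hv : ∑ k ∈ Finset.range n, ‖v k‖ ≤ q) (he : ∑ k ∈ Finset.range n, ‖v k - v' k‖ ≤ e) :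
    ‖∑ k ∈ Finset.range n, c k • v k - ∑ k ∈ Finset.range n, c' k • v' k‖ ≤ p * q + e := by
  have h1 : ∑ k ∈ Finset.range n, c k • v k - ∑ k ∈ Finset.range n, c' k • v' k =
      ∑ k ∈ Finset.range n, (c k - c' k) • v k +
        ∑ k ∈ Finset.range n, c' k • (v k - v' k) := by
    rw [← Finset.sum_sub_distrib, ← Finset.sum_add_distrib]
    refine Finset.sum_congr rfl fun k _ => ?_
    rw [sub_smul, smul_sub]; abel
  rw [h1]
  refine (norm_add_le _ _).trans (add_le_add (norm_sum_smul_le hcc hp hv) ?_)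
  simpa using norm_sum_smul_le hc' zero_le_one he

lemma Net.IsBounded.abs_pre_le_of (hN : N.IsBounded) {l : ℕ} {q : ℝ}
    (hq : ∑ k ∈ Finset.range (fanIn d W l), |N.act d W z l k| ≤ q) (i : ℕ) :
    |N.pre d W z l i| ≤ q + 1 := by
  refine (abs_add_le _ _).trans (add_le_add ?_ (hN.2 l i))
  simpa using norm_sum_smul_le (V := ℝ) (hN.1 l i) zero_le_one hq

lemma Net.IsBounded.sum_abs_act_le (hN : N.IsBounded)
    (hz : ∑ k ∈ Finset.range (d + 1), |z k| ≤ 2 * W) :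
    ∀ l, ∑ k ∈ Finset.range (fanIn d W l), |N.act d W z l k| ≤ actBound W l
  | 0 => hz
  | l + 1 => by
    have ih := hN.abs_pre_le_of (hN.sum_abs_act_le hz l)
    calc ∑ k ∈ Finset.range W, |requ (N.pre d W z l k)|
        ≤ ∑ k ∈ Finset.range W, (actBound W l + 1) ^ 2 := by
          refine Finset.sum_le_sum fun k _ => ?_
          rw [abs_of_nonneg (requ_nonneg _)]
          exact requ_le (ih k)
      _ = actBound W (l + 1) := by simp [actBound]

lemma Net.IsBounded.abs_pre_le (hN : N.IsBounded)
    (hz : ∑ k ∈ Finset.range (d + 1), |z k| ≤ 2 * W) (l i : ℕ) :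
    |N.pre d W z l i| ≤ actBound W l + 1 :=
  hN.abs_pre_le_of (hN.sum_abs_act_le hz l) i

/-- `A` dominates the growth factors of the first `M` layers. -/
structure GrowthBound (W M : ℕ) (A : ℝ) : Prop where
  growth : ∀ l < M, 2 * W * (actBound W l + 1) ≤ A / 3
  sq_le : 4 * (W : ℝ) ^ 2 ≤ A
  out_le : W * actBound W M ≤ A / 2
  one_le_W : 1 ≤ W

lemma GrowthBound.one_le (hA : GrowthBound W M A) : 1 ≤ A := by
  have h1 : (1 : ℝ) ≤ W := by exact_mod_cast hA.one_le_W
  nlinarith [hA.sq_le]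

lemma GrowthBound.W_le (hA : GrowthBound W M A) : (W : ℝ) ≤ A / 4 := by
  have h1 : (1 : ℝ) ≤ W := by exact_mod_cast hA.one_le_W
  nlinarith [hA.sq_le]

lemma GrowthBound.actBound_le (hA : GrowthBound W M A) {l : ℕ} (hl : l < M) :
    actBound W l + 1 ≤ A := by
  have h1 : (1 : ℝ) ≤ W := by exact_mod_cast hA.one_le_W
  nlinarith [hA.growth l hl, actBound_nonneg W l, hA.one_le]

/-- A layer multiplies the `ℓ¹` norm of the tangents by at most `W` (number of units) times `2 *
(actBound W l + 1)` (slope of the activation), since the weights are at most `1`. -/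
lemma GrowthBound.sum_norm_tan_le (hA : GrowthBound W M A) (hN : N.IsBounded)
    (hz : ∑ k ∈ Finset.range (d + 1), |z k| ≤ 2 * W)
    (hJ : ∑ k ∈ Finset.range (d + 1), ‖J k‖ ≤ W) :
    ∀ l ≤ M, ∑ k ∈ Finset.range (fanIn d W l), ‖N.tan d W z J l k‖ ≤ W * A ^ l
  | 0, _ => by simpa [Net.tan, fanIn] using hJ
  | l + 1, hl => by
    have ih := hA.sum_norm_tan_le hN hz hJ l (by omega)
    have h1 := hA.growth l hl
    have h2 := actBound_nonneg W l
    have hA1 := hA.one_le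
    calc ∑ k ∈ Finset.range W, ‖N.tan d W z J (l + 1) k‖
        ≤ ∑ k ∈ Finset.range W, 2 * (actBound W l + 1) * (1 * (W * A ^ l)) := by
          refine Finset.sum_le_sum fun i _ => ?_
          simp only [Net.tan]
          rw [norm_smul, Real.norm_eq_abs, abs_mul, abs_two]
          gcongr
          · exact (abs_max_zero_le _).trans (hN.abs_pre_le hz l i)
          · exact norm_sum_smul_le (hN.1 l i) zero_le_one ih
      _ = 2 * W * (actBound W l + 1) * (W * A ^ l) := by
          rw [Finset.sum_const, Finset.card_range, nsmul_eq_mul]; ring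
      _ ≤ A * (W * A ^ l) := by gcongr; linarith
      _ = W * A ^ (l + 1) := by ring

/-- The error has three sources: weights, biases and inputs. Requiring `A * p ≤ δ` lets the single
quantity `δ` absorb the first two, so that one recursion handles parameters and inputs together. -/
lemma GrowthBound.abs_pre_sub_le (hA : GrowthBound W M A) (hN : N.IsBounded)
    (hN' : N'.IsBounded) (hp : 0 ≤ p) (hNN : N.Within N' p)
    (hz : ∑ k ∈ Finset.range (d + 1), |z k| ≤ 2 * W) (hδ : A * p ≤ δ) {l : ℕ} (hl : l < M)
    (h : ∑ k ∈ Finset.range (fanIn d W l), |N.act d W z l k - N'.act d W z' l k| ≤ A ^ l * δ)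
    (i : ℕ) :
    |N.pre d W z l i - N'.pre d W z' l i| ≤ 2 * (A ^ l * δ) := by
  have hA1 := hA.one_le
  have h1 := norm_sum_smul_sub_le (V := ℝ) (hN'.1 l i) (hNN.1 l i) hp (hN.sum_abs_act_le hz l) h
  have h2 : N.pre d W z l i - N'.pre d W z' l i =
      (∑ k ∈ Finset.range (fanIn d W l), N.weight l i k • N.act d W z l k -
        ∑ k ∈ Finset.range (fanIn d W l), N'.weight l i k • N'.act d W z' l k) +
      (N.bias l i - N'.bias l i) := by
    simp only [Net.pre, smul_eq_mul]; ring
  rw [h2]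
  refine (abs_add_le _ _).trans ?_
  have h3 : p * (actBound W l + 1) ≤ A * p := by
    rw [mul_comm]; gcongr; exact hA.actBound_le hl
  have h4 : δ ≤ A ^ l * δ :=
    le_mul_of_one_le_left ((by positivity : 0 ≤ A * p).trans hδ) (one_le_pow₀ hA1)
  rw [Real.norm_eq_abs] at h1
  linarith [hNN.2 l i]

/-- The factor `2` lost in `GrowthBound.abs_pre_sub_le` is paid for by the margin `A / 3` in
`GrowthBound.growth`, so the rate remains `A` per layer. -/
lemma GrowthBound.sum_abs_act_sub_le (hA : GrowthBound W M A) (hN : N.IsBounded)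
    (hN' : N'.IsBounded) (hp : 0 ≤ p) (hNN : N.Within N' p)
    (hz : ∑ k ∈ Finset.range (d + 1), |z k| ≤ 2 * W)
    (hz' : ∑ k ∈ Finset.range (d + 1), |z' k| ≤ 2 * W) (hδ : A * p ≤ δ)
    (hzz : ∑ k ∈ Finset.range (d + 1), |z k - z' k| ≤ δ) :
    ∀ l ≤ M, ∑ k ∈ Finset.range (fanIn d W l), |N.act d W z l k - N'.act d W z' l k| ≤ A ^ l * δ
  | 0, _ => by simpa [Net.act, fanIn] using hzz
  | l + 1, hl => by
    have hA1 := hA.one_le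
    have h0 : 0 ≤ δ := (by positivity : 0 ≤ A * p).trans hδ
    have ih := hA.sum_abs_act_sub_le hN hN' hp hNN hz hz' hδ hzz l (by omega)
    have h1 := hA.abs_pre_sub_le hN hN' hp hNN hz hδ hl ih
    have h2 := actBound_nonneg W l
    have h3 := hA.growth l hl
    calc ∑ k ∈ Finset.range W, |requ (N.pre d W z l k) - requ (N'.pre d W z' l k)|
        ≤ ∑ k ∈ Finset.range W, 2 * (actBound W l + 1) * (2 * (A ^ l * δ)) := by
          refine Finset.sum_le_sum fun i _ => ?_
          refine (abs_requ_sub_le (hN.abs_pre_le hz l i) (hN'.abs_pre_le hz' l i)).trans ?_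
          gcongr
          exact h1 i
      _ = 2 * W * (actBound W l + 1) * (2 * (A ^ l * δ)) := by
          rw [Finset.sum_const, Finset.card_range, nsmul_eq_mul]; ring
      _ ≤ A / 3 * (2 * (A ^ l * δ)) := by gcongr
      _ ≤ A ^ (l + 1) * δ := by
          have : 0 ≤ A ^ (l + 1) * δ := by positivity
          rw [pow_succ] at this ⊢
          linarith

/-- Product rule: a tangent changes through the activation slope and through the incoming tangents.
The first contribution is an activation error of order `A ^ l` times a tangent of order `A ^ l`,
which explains the rate `A ^ (2 * l)`. The constant `3` is preserved because one layer produces at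
most `7 / 3 * A ≤ 3 * A ^ 2`. -/
lemma GrowthBound.sum_norm_tan_sub_le (hA : GrowthBound W M A) (hN : N.IsBounded)
    (hN' : N'.IsBounded) (hp : 0 ≤ p) (hNN : N.Within N' p)
    (hz : ∑ k ∈ Finset.range (d + 1), |z k| ≤ 2 * W)
    (hz' : ∑ k ∈ Finset.range (d + 1), |z' k| ≤ 2 * W) (hδ : A * p ≤ δ)
    (hzz : ∑ k ∈ Finset.range (d + 1), |z k - z' k| ≤ δ)
    (hJ : ∑ k ∈ Finset.range (d + 1), ‖J k‖ ≤ W) :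
    ∀ l ≤ M, ∑ k ∈ Finset.range (fanIn d W l), ‖N.tan d W z J l k - N'.tan d W z' J l k‖ ≤
      3 * A ^ (2 * l) * δ
  | 0, _ => by
    have h0 : 0 ≤ δ := (mul_nonneg (zero_le_one.trans hA.one_le) hp).trans hδ
    simpa [Net.tan] using h0
  | l + 1, hl => by
    have hA1 := hA.one_le
    have h0 : 0 ≤ δ := (by positivity : 0 ≤ A * p).trans hδ
    have ih := hA.sum_norm_tan_sub_le hN hN' hp hNN hz hz' hδ hzz hJ l (by omega)
    have h1 := hA.abs_pre_sub_le hN hN' hp hNN hz hδ hl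
      (hA.sum_abs_act_sub_le hN hN' hp hNN hz hz' hδ hzz l (by omega))
    have h2 := actBound_nonneg W l
    have h3 := hA.growth l hl
    have h4 := hA.sum_norm_tan_le hN hz hJ l (by omega)
    calc ∑ k ∈ Finset.range W, ‖N.tan d W z J (l + 1) k - N'.tan d W z' J (l + 1) k‖
        ≤ ∑ k ∈ Finset.range W, (2 * (2 * (A ^ l * δ)) * (1 * (W * A ^ l)) +
            2 * (actBound W l + 1) * (p * (W * A ^ l) + 3 * A ^ (2 * l) * δ)) := by
          refine Finset.sum_le_sum fun i _ => ?_
          simp only [Net.tan]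
          set s := 2 * max (N.pre d W z l i) 0
          set s' := 2 * max (N'.pre d W z' l i) 0
          set T := ∑ k ∈ Finset.range (fanIn d W l), N.weight l i k • N.tan d W z J l k
          set T' := ∑ k ∈ Finset.range (fanIn d W l), N'.weight l i k • N'.tan d W z' J l k
          have e1 : s • T - s' • T' = (s - s') • T + s' • (T - T') := by
            rw [sub_smul, smul_sub]; abel
          rw [e1]
          refine (norm_add_le _ _).trans ?_
          rw [norm_smul, norm_smul]
          gcongr
          · rw [Real.norm_eq_abs, ← mul_sub, abs_mul, abs_two]
            gcongr
            exact (abs_max_sub_max_le _ _).trans (h1 i)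
          · exact norm_sum_smul_le (hN.1 l i) zero_le_one h4
          · rw [Real.norm_eq_abs, abs_mul, abs_two]
            gcongr
            exact (abs_max_zero_le _).trans (hN'.abs_pre_le hz' l i)
          · exact norm_sum_smul_sub_le (hN'.1 l i) (hNN.1 l i) hp h4 ih
      _ = 4 * W ^ 2 * (A ^ (2 * l) * δ) +
            2 * W * (actBound W l + 1) * (W * p * A ^ l + 3 * (A ^ (2 * l) * δ)) := by
          rw [Finset.sum_const, Finset.card_range, nsmul_eq_mul]; ring
      _ ≤ A * (A ^ (2 * l) * δ) + A / 3 * (A ^ (2 * l) * δ + 3 * (A ^ (2 * l) * δ)) := by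
          have h5 : W * p * A ^ l ≤ A ^ (2 * l) * δ := by
            rw [mul_comm]
            refine mul_le_mul (pow_le_pow_right₀ hA1 (by omega)) ?_ (by positivity) (by positivity)
            exact (mul_le_mul_of_nonneg_right (by linarith [hA.W_le]) hp).trans hδ
          have h6 : 0 ≤ A ^ (2 * l) * δ := by positivity
          have h7 : 0 ≤ W * p * A ^ l := by positivity
          exact add_le_add (mul_le_mul_of_nonneg_right hA.sq_le h6)
            (mul_le_mul h3 (by linarith) (by linarith) (by positivity))
      _ = 7 / 3 * (A * (A ^ (2 * l) * δ)) := by ring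
      _ ≤ 3 * (A * A * (A ^ (2 * l) * δ)) := by
          have h5 : 0 ≤ A ^ (2 * l) * δ := by positivity
          have h6 : A * (A ^ (2 * l) * δ) ≤ A * (A * (A ^ (2 * l) * δ)) := by
            exact mul_le_mul_of_nonneg_left (le_mul_of_one_le_left h5 hA1) (by positivity)
          nlinarith [mul_nonneg (zero_le_one.trans hA1) h5]
      _ = 3 * A ^ (2 * (l + 1)) * δ := by ring

end Net

/-! ### The network as a vector field with Lipschitz dependence on parameters. -/

section Field

variable {d W : ℕ} {N N' : Net} {A p : ℝ} {M : ℕ}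

/-- The input `(y, t)` of the network. -/
def netInput (y : Vec d) (t : ℝ) (k : ℕ) : ℝ := if h : k < d then y ⟨k, h⟩ else t

/-- The derivatives of the inputs with respect to `y`. -/
noncomputable def inputTan (d : ℕ) (k : ℕ) : Vec d →L[ℝ] ℝ :=
  if h : k < d then EuclideanSpace.proj ⟨k, h⟩ else 0

/-- The vector field of the network with `M` hidden layers. -/
noncomputable def Net.field (N : Net) (d W M : ℕ) (y : Vec d) (t : ℝ) : Vec d :=
  ∑ j : Fin d, (∑ k ∈ Finset.range (fanIn d W M),
    N.weight M j k • N.act d W (netInput y t) M k) • EuclideanSpace.single j (1 : ℝ)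

/-- The spatial derivative of the vector field of the network. -/
noncomputable def Net.fieldDeriv (N : Net) (d W M : ℕ) (y : Vec d) (t : ℝ) :
    Vec d →L[ℝ] Vec d :=
  ∑ j : Fin d, (∑ k ∈ Finset.range (fanIn d W M),
    N.weight M j k • N.tan d W (netInput y t) (inputTan d) M k).smulRight
      (EuclideanSpace.single j (1 : ℝ))

lemma hasFDerivAt_netInput (y : Vec d) (t : ℝ) (k : ℕ) :
    HasFDerivAt (fun x => netInput x t k) (inputTan d k) y := by
  unfold netInput inputTan
  split_ifs with h
  · exact (EuclideanSpace.proj (𝕜 := ℝ) (⟨k, h⟩ : Fin d)).hasFDerivAt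
  · exact hasFDerivAt_const t y

lemma Net.hasFDerivAt_act (N : Net) (y : Vec d) (t : ℝ) :
    ∀ l i, HasFDerivAt (fun x => N.act d W (netInput x t) l i)
      (N.tan d W (netInput y t) (inputTan d) l i) y
  | 0, i => hasFDerivAt_netInput y t i
  | l + 1, i => by
    have h1 : HasFDerivAt (fun x => N.pre d W (netInput x t) l i)
        (∑ k ∈ Finset.range (fanIn d W l),
          N.weight l i k • N.tan d W (netInput y t) (inputTan d) l k) y := by
      refine (HasFDerivAt.fun_sum fun k _ => ?_).add_const _
      exact (N.hasFDerivAt_act y t l k).const_mul (N.weight l i k)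
    exact (hasDerivAt_requ (N.pre d W (netInput y t) l i)).comp_hasFDerivAt y h1

lemma Net.hasFDerivAt_field (N : Net) (y : Vec d) (t : ℝ) :
    HasFDerivAt (fun x => N.field d W M x t) (N.fieldDeriv d W M y t) y := by
  refine HasFDerivAt.fun_sum fun j _ => HasFDerivAt.smul_const ?_ _
  refine HasFDerivAt.fun_sum fun k _ => ?_
  exact (N.hasFDerivAt_act y t M k).const_mul (N.weight M j k)

lemma Net.continuous_act (N : Net) (t : ℝ) (l i : ℕ) :
    Continuous fun y : Vec d => N.act d W (netInput y t) l i :=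
  continuous_iff_continuousAt.mpr fun y => (N.hasFDerivAt_act y t l i).continuousAt

lemma Net.continuous_tan (N : Net) (t : ℝ) :
    ∀ l i, Continuous fun y : Vec d => N.tan d W (netInput y t) (inputTan d) l i
  | 0, _ => continuous_const
  | l + 1, i => by
    have h1 := N.continuous_act (d := d) (W := W) t l
    have h2 := N.continuous_tan t l
    simp only [Net.tan, Net.pre]
    fun_prop

lemma Net.continuous_fieldDeriv (N : Net) (t : ℝ) :
    Continuous fun y : Vec d => N.fieldDeriv d W M y t := by
  have h2 := N.continuous_tan (d := d) (W := W) t M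
  unfold Net.fieldDeriv
  refine continuous_finsetSum _ fun j _ => ?_
  have h3 : Continuous fun y : Vec d => ∑ k ∈ Finset.range (fanIn d W M),
    N.weight M j k • N.tan d W (netInput y t) (inputTan d) M k := by fun_prop
  exact ((ContinuousLinearMap.smulRightL ℝ (Vec d) (Vec d)).flip
    (EuclideanSpace.single j (1 : ℝ))).continuous.comp h3

lemma abs_apply_le_norm (y : Vec d) (j : Fin d) : |y j| ≤ ‖y‖ := by
  simpa using PiLp.norm_apply_le y j

lemma sum_abs_netInput_le (hdW : d ≤ W) (hd : 1 ≤ d) {y : Vec d} {t : ℝ} (hy : ‖y‖ ≤ 1)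
    (ht : t ∈ Icc (0 : ℝ) 1) : ∑ k ∈ Finset.range (d + 1), |netInput y t k| ≤ 2 * W := by
  have h1 : ∀ k ∈ Finset.range (d + 1), |netInput y t k| ≤ 1 := by
    intro k _
    unfold netInput
    split_ifs with h
    · exact (abs_apply_le_norm y _).trans hy
    · rw [abs_of_nonneg ht.1]; exact ht.2
  refine (Finset.sum_le_sum h1).trans ?_
  simp only [Finset.sum_const, Finset.card_range, nsmul_eq_mul, mul_one]
  have : d + 1 ≤ 2 * W := by omega
  exact_mod_cast this

lemma sum_abs_netInput_sub_le (hdW : d ≤ W) (y y' : Vec d) (t : ℝ) :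
    ∑ k ∈ Finset.range (d + 1), |netInput y t k - netInput y' t k| ≤ W * ‖y - y'‖ := by
  rw [Finset.sum_range_succ]
  have h0 : |netInput y t d - netInput y' t d| = 0 := by simp [netInput]
  have h1 : ∀ k ∈ Finset.range d, |netInput y t k - netInput y' t k| ≤ ‖y - y'‖ := by
    intro k hk
    have hk' := Finset.mem_range.mp hk
    simp only [netInput, hk', dite_true]
    exact abs_apply_le_norm (y - y') ⟨k, hk'⟩
  rw [h0, add_zero]
  refine (Finset.sum_le_sum h1).trans ?_
  simp only [Finset.sum_const, Finset.card_range, nsmul_eq_mul]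
  gcongr

lemma sum_norm_inputTan_le (hdW : d ≤ W) :
    ∑ k ∈ Finset.range (d + 1), ‖inputTan d k‖ ≤ W := by
  rw [Finset.sum_range_succ]
  have h0 : ‖inputTan d d‖ = 0 := by simp [inputTan]
  have h1 : ∀ k ∈ Finset.range d, ‖inputTan d k‖ ≤ 1 := by
    intro k hk
    have hk' := Finset.mem_range.mp hk
    simp only [inputTan, hk', dite_true]
    refine ContinuousLinearMap.opNorm_le_bound _ zero_le_one fun y => ?_
    rw [one_mul]
    exact abs_apply_le_norm y ⟨k, hk'⟩
  rw [h0, add_zero]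
  refine (Finset.sum_le_sum h1).trans ?_
  simp only [Finset.sum_const, Finset.card_range, nsmul_eq_mul, mul_one]
  exact_mod_cast hdW

lemma norm_single_one (j : Fin d) : ‖(EuclideanSpace.single j (1 : ℝ) : Vec d)‖ = 1 := by
  simp

lemma norm_sum_le_mul {V : Type*} [SeminormedAddCommGroup V] {f : Fin d → V} {c : ℝ}
    (hdW : d ≤ W) (hc : 0 ≤ c) (hf : ∀ j, ‖f j‖ ≤ c) : ‖∑ j, f j‖ ≤ W * c := by
  refine (norm_sum_le_of_le _ fun j _ => hf j).trans ?_
  simp only [Finset.sum_const, Finset.card_univ, Fintype.card_fin, nsmul_eq_mul]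
  gcongr

lemma GrowthBound.fieldBound (hA : GrowthBound W M A) (hdW : d ≤ W) (hd : 1 ≤ d)
    (hN : N.IsBounded) :
    FieldBound (N.field d W M) (N.fieldDeriv d W M) (A / 2) (W ^ 2 * A ^ M) where
  hasFDerivAt y t := N.hasFDerivAt_field y t
  continuous_deriv t := N.continuous_fieldDeriv t
  norm_le y t hy ht := by
    refine le_trans ?_ hA.out_le
    refine norm_sum_le_mul hdW (actBound_nonneg W M) fun j => ?_
    rw [norm_smul, norm_single_one, mul_one]
    simpa using norm_sum_smul_le (V := ℝ) (hN.1 M j) zero_le_one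
      (hN.sum_abs_act_le (sum_abs_netInput_le hdW hd hy ht) M)
  norm_deriv_le y t hy ht := by
    have hA1 := hA.one_le
    rw [pow_two, mul_assoc]
    refine norm_sum_le_mul hdW (by positivity) fun j => ?_
    rw [ContinuousLinearMap.norm_smulRight_apply, norm_single_one, mul_one]
    simpa using norm_sum_smul_le (hN.1 M j) zero_le_one
      (hA.sum_norm_tan_le hN (sum_abs_netInput_le hdW hd hy ht) (sum_norm_inputTan_le hdW) M le_rfl)

/-- The layerwise bounds are applied with `δ = W * ‖y - y'‖ + A * p`: the inputs are measured in
`ℓ¹`, which costs the factor `W`. The linear output layer then adds its own weight error. -/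
lemma GrowthBound.fieldClose (hA : GrowthBound W M A) (hdW : d ≤ W) (hd : 1 ≤ d)
    (hN : N.IsBounded) (hN' : N'.IsBounded) (hp : 0 ≤ p) (hNN : N.Within N' p) :
    FieldClose (N.field d W M) (N.fieldDeriv d W M) (N'.field d W M) (N'.fieldDeriv d W M)
      (W ^ 2 * A ^ M) (3 * W ^ 2 * A ^ (2 * M)) (W * (A ^ (M + 1) + A) * p)
      ((3 * W * A ^ (2 * M + 1) + W ^ 2 * A ^ M) * p) where
  norm_sub_le y y' t hy hy' ht := by
    have hA1 := hA.one_le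
    have h1 := sum_abs_netInput_le hdW hd hy ht
    have h2 := sum_abs_netInput_le hdW hd hy' ht
    have h3 := hA.sum_abs_act_sub_le hN hN' hp hNN h1 h2 (δ := W * ‖y - y'‖ + A * p)
      (le_add_of_nonneg_left (by positivity))
      ((sum_abs_netInput_sub_le hdW y y' t).trans (le_add_of_nonneg_right (by positivity)))
      M le_rfl
    have h4 : actBound W M ≤ A := by
      have h1 : (1 : ℝ) ≤ W := by exact_mod_cast hA.one_le_W
      nlinarith [hA.out_le, actBound_nonneg W M]
    have h5 : ‖N.field d W M y t - N'.field d W M y' t‖ ≤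
        W * (p * A + A ^ M * (W * ‖y - y'‖ + A * p)) := by
      unfold Net.field
      rw [← Finset.sum_sub_distrib]
      refine norm_sum_le_mul hdW (by positivity) fun j => ?_
      rw [← sub_smul, norm_smul, norm_single_one, mul_one]
      exact norm_sum_smul_sub_le (V := ℝ) (hN'.1 M j) (hNN.1 M j) hp
        ((hN.sum_abs_act_le h1 M).trans h4) h3
    refine h5.trans_eq ?_
    ring
  norm_deriv_sub_le y y' t hy hy' ht := by
    have hA1 := hA.one_le
    have h1 := sum_abs_netInput_le hdW hd hy ht
    have h2 := sum_abs_netInput_le hdW hd hy' ht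
    have h3 := hA.sum_norm_tan_sub_le hN hN' hp hNN h1 h2 (δ := W * ‖y - y'‖ + A * p)
      (le_add_of_nonneg_left (by positivity))
      ((sum_abs_netInput_sub_le hdW y y' t).trans (le_add_of_nonneg_right (by positivity)))
      (sum_norm_inputTan_le hdW) M le_rfl
    have h5 : ‖N.fieldDeriv d W M y t - N'.fieldDeriv d W M y' t‖ ≤
        W * (p * (W * A ^ M) + 3 * A ^ (2 * M) * (W * ‖y - y'‖ + A * p)) := by
      unfold Net.fieldDeriv
      rw [← Finset.sum_sub_distrib]
      refine norm_sum_le_mul hdW (by positivity) fun j => ?_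
      rw [← ContinuousLinearMap.smulRightL_apply_apply, ← ContinuousLinearMap.smulRightL_apply_apply]
      rw [← sub_apply, ← map_sub,
        ContinuousLinearMap.smulRightL_apply_apply,
        ContinuousLinearMap.norm_smulRight_apply, norm_single_one, mul_one]
      exact norm_sum_smul_sub_le (hN'.1 M j) (hNN.1 M j) hp
        (hA.sum_norm_tan_le hN h1 (sum_norm_inputTan_le hdW) M le_rfl) h3
    refine h5.trans_eq ?_
    ring

end Field

/-! ### Sub-Gaussian deviations and a maximal inequality. -/

section EmpiricalProcess

variable {V : Type*} [MeasurableSpace V] {S : Type*} [MeasurableSpace S] {n : ℕ}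

/-- The deviation of the expectation of `g` from its sample mean. -/
noncomputable def deviation (μ : Measure V) (X : Fin n → S → V) (g : V → ℝ) (s : S) : ℝ :=
  ∫ x, g x ∂μ - (1 / n : ℝ) * ∑ i, g (X i s)

variable {μ : Measure V} {P : Measure S} {X : Fin n → S → V} {g g' : V → ℝ} {b : ℝ}

lemma measurable_deviation (hX : ∀ i, Measurable (X i)) (hg : Measurable g) :
    Measurable (deviation μ X g) := by
  unfold deviation
  have := fun i => hg.comp (hX i)
  simp only [Function.comp_def] at this
  fun_prop

lemma deviation_sub {S : Type*} {X : Fin n → S → V} (hg : Integrable g μ) (hg' : Integrable g' μ) (s : S) :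
    deviation μ X (fun x => g x - g' x) s = deviation μ X g s - deviation μ X g' s := by
  simp only [deviation, integral_sub hg hg', Finset.sum_sub_distrib]
  ring

variable [IsProbabilityMeasure P]

lemma integrable_of_abs_le [IsProbabilityMeasure μ] (hg : Measurable g) (hb : ∀ x, |g x| ≤ b) : Integrable g μ :=
  Integrable.of_bound hg.aestronglyMeasurable b (Filter.Eventually.of_forall hb)

lemma abs_deviation_le {S : Type*} {X : Fin n → S → V} [IsProbabilityMeasure μ] (hn : 1 ≤ n) (hb : ∀ x, |g x| ≤ b) (s : S) :
    |deviation μ X g s| ≤ 2 * b := by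
  have hn' : (0 : ℝ) < n := by exact_mod_cast hn
  have h1 : |∫ x, g x ∂μ| ≤ b := by
    simpa using norm_integral_le_of_norm_le_const (μ := μ) (f := g)
      (Filter.Eventually.of_forall hb)
  have h2 : |(1 / n : ℝ) * ∑ i, g (X i s)| ≤ b := by
    rw [abs_mul, abs_of_pos (by positivity)]
    have h3 : |∑ i, g (X i s)| ≤ n * b := by
      refine (Finset.abs_sum_le_sum_abs _ _).trans ((Finset.sum_le_sum fun i _ => hb _).trans ?_)
      simp
    calc (1 / n : ℝ) * |∑ i, g (X i s)| ≤ 1 / n * (n * b) := by gcongr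
      _ = b := by field_simp
  exact (abs_sub _ _).trans (by linarith)

/-- Hoeffding's lemma on an interval of length `2 * b` gives the parameter `b ^ 2` per sample; by
independence the sum has `n * b ^ 2`, and scaling by `1 / n` leaves `b ^ 2 / n`. -/
lemma hasSubgaussianMGF_deviation (hn : 1 ≤ n) (hX : ∀ i, Measurable (X i))
    (hlaw : ∀ i, P.map (X i) = μ) (hindep : iIndepFun X P) (hg : Measurable g) (hb0 : 0 ≤ b)
    (hb : ∀ x, |g x| ≤ b) :
    HasSubgaussianMGF (deviation μ X g) (Real.toNNReal (b ^ 2 / n)) P := by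
  have hn' : (0 : ℝ) < n := by exact_mod_cast hn
  have hmean : ∀ i, ∫ s, g (X i s) ∂P = ∫ x, g x ∂μ := fun i => by
    rw [← hlaw i, integral_map (hX i).aemeasurable hg.aestronglyMeasurable]
  have h1 : ∀ i, HasSubgaussianMGF (fun s => g (X i s) - ∫ x, g x ∂μ) ((‖b - -b‖₊ / 2) ^ 2) P := by
    intro i
    have := hasSubgaussianMGF_of_mem_Icc (μ := P) (X := fun s => g (X i s)) (a := -b) (b := b)
      (hg.comp (hX i)).aemeasurable (Filter.Eventually.of_forall fun s => abs_le.mp (hb _))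
    simpa only [hmean i] using this
  have h2 : iIndepFun (fun i s => g (X i s) - ∫ x, g x ∂μ) P :=
    hindep.comp (fun _ x => g x - ∫ x, g x ∂μ) fun _ => hg.sub_const _
  have h3 := HasSubgaussianMGF.sum_of_iIndepFun h2 (s := Finset.univ) fun i _ => h1 i
  have h4 := h3.const_mul (-(1 / n : ℝ))
  convert h4 using 1
  · funext s
    simp only [deviation, Finset.sum_sub_distrib, Finset.sum_const, Finset.card_univ,
      Fintype.card_fin, nsmul_eq_mul]
    field_simp
    ring
  · ext
    rw [Real.coe_toNNReal _ (by positivity)]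
    change _ = (-(1 / n : ℝ)) ^ 2 * ((∑ _i : Fin n, (‖b - -b‖₊ / 2) ^ 2 : ℝ≥0) : ℝ)
    have : ‖b - -b‖ = 2 * b := by
      rw [sub_neg_eq_add, Real.norm_of_nonneg (by positivity)]; ring
    simp only [NNReal.coe_mul, NNReal.coe_natCast, NNReal.coe_pow, NNReal.coe_div, coe_nnnorm, this, Finset.sum_const,
      Finset.card_univ, Fintype.card_fin, nsmul_eq_mul, NNReal.coe_ofNat]
    field_simp

lemma integrable_exp_abs_deviation [IsProbabilityMeasure μ] (hn : 1 ≤ n) (hX : ∀ i, Measurable (X i)) (hg : Measurable g)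
    (hb : ∀ x, |g x| ≤ b) {r : ℝ} (hr : 0 ≤ r) :
    Integrable (fun s => Real.exp (r * |deviation μ X g s|)) P := by
  refine Integrable.of_bound (C := Real.exp (r * (2 * b))) ?_ ?_
  · exact (Real.measurable_exp.comp
      ((measurable_deviation hX hg).abs.const_mul r)).aestronglyMeasurable
  · refine Filter.Eventually.of_forall fun s => ?_
    rw [Real.norm_of_nonneg (Real.exp_pos _).le]
    have := abs_deviation_le (μ := μ) (X := X) hn hb s
    gcongr

/-- The rate `√n / b` normalizes the sub-Gaussian exponent to `1 / 2`; the absolute value costs a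
factor `2` through `exp |x| ≤ exp x + exp (-x)`. -/
lemma integral_exp_abs_deviation_le [IsProbabilityMeasure μ] (hn : 1 ≤ n) (hX : ∀ i, Measurable (X i))
    (hlaw : ∀ i, P.map (X i) = μ) (hindep : iIndepFun X P) (hg : Measurable g) (hb0 : 0 < b)
    (hb : ∀ x, |g x| ≤ b) :
    ∫ s, Real.exp (Real.sqrt n / b * |deviation μ X g s|) ∂P ≤ 2 * Real.exp (1 / 2) := by
  have hn' : (0 : ℝ) < n := by exact_mod_cast hn
  have hsub := hasSubgaussianMGF_deviation hn hX hlaw hindep hg hb0.le hb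
  have hval : ∀ r : ℝ, r ^ 2 = n / b ^ 2 → mgf (deviation μ X g) P r ≤ Real.exp (1 / 2) := by
    intro r hr
    refine (hsub.mgf_le r).trans_eq ?_
    rw [hr, Real.coe_toNNReal _ (by positivity)]
    congr 1
    field_simp
  have h1 := hval (Real.sqrt n / b) (by rw [div_pow, Real.sq_sqrt hn'.le])
  have h2 := hval (-(Real.sqrt n / b)) (by rw [neg_sq, div_pow, Real.sq_sqrt hn'.le])
  calc ∫ s, Real.exp (Real.sqrt n / b * |deviation μ X g s|) ∂P
      ≤ ∫ s, (Real.exp (Real.sqrt n / b * deviation μ X g s) +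
          Real.exp (-(Real.sqrt n / b) * deviation μ X g s)) ∂P := by
        refine integral_mono (integrable_exp_abs_deviation hn hX hg hb (by positivity))
          ((hsub.integrable_exp_mul _).add (hsub.integrable_exp_mul _)) fun s => ?_
        dsimp only
        rcases abs_cases (deviation μ X g s) with ⟨h, -⟩ | ⟨h, -⟩ <;> rw [h]
        · linarith [Real.exp_pos (-(Real.sqrt n / b) * deviation μ X g s)]
        · rw [mul_neg, ← neg_mul]
          linarith [Real.exp_pos (Real.sqrt n / b * deviation μ X g s)]
    _ = mgf (deviation μ X g) P (Real.sqrt n / b) + mgf (deviation μ X g) P (-(Real.sqrt n / b)) :=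
        integral_add (hsub.integrable_exp_mul _) (hsub.integrable_exp_mul _)
    _ ≤ _ := by linarith

/-- A measurable majorant of finitely many deviations, with the expectation given by the maximal
inequality for sub-Gaussian variables. -/
lemma exists_majorant_deviation [IsProbabilityMeasure μ] (hn : 1 ≤ n) (hX : ∀ i, Measurable (X i))
    (hlaw : ∀ i, P.map (X i) = μ) (hindep : iIndepFun X P) {κ : Type*} (s : Finset κ)
    {f : κ → V → ℝ} (hf : ∀ c ∈ s, Measurable (f c)) (hb0 : 0 < b)
    (hb : ∀ c ∈ s, ∀ x, |f c x| ≤ b) {M : ℝ} (hM : s.card ≤ M) (hM1 : 1 ≤ M) :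
    ∃ Y : S → ℝ, Measurable Y ∧ (∀ c ∈ s, ∀ ω, |deviation μ X (f c) ω| ≤ Y ω) ∧
      ∫⁻ ω, ENNReal.ofReal (Y ω) ∂P ≤
        ENNReal.ofReal (b / Real.sqrt n * (Real.log (2 * M) + 1 / 2)) := by
  have hn' : (0 : ℝ) < n := by exact_mod_cast hn
  have hsq : 0 < Real.sqrt n := Real.sqrt_pos.mpr hn'
  set r := Real.sqrt n / b with hr
  have hr0 : 0 < r := by positivity
  set Q := 2 * M * Real.exp (1 / 2) with hQ
  have hQ0 : 0 < Q := by positivity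
  have hlogQ : Real.log Q = Real.log (2 * M) + 1 / 2 := by
    rw [hQ, Real.log_mul (by positivity) (by positivity), Real.log_exp]
  -- This makes the majorant below nonnegative, so its `lintegral` is its integral.
  have hlog1 : 1 ≤ Real.log Q := by
    have h1 := Real.log_two_gt_d9
    have h2 : Real.log 2 ≤ Real.log (2 * M) := Real.log_le_log (by norm_num) (by linarith)
    rw [hlogQ]; linarith
  have hint : ∀ c ∈ s, Integrable (fun ω => Real.exp (r * |deviation μ X (f c) ω|)) P :=
    fun c hc => integrable_exp_abs_deviation hn hX (hf c hc) (hb c hc) hr0.le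
  -- The maximum is at most `r⁻¹` times the logarithm of the exponential sum. Replacing the
  -- logarithm by its tangent at `Q` gives a majorant affine in that sum, so its mean follows by
  -- linearity. As the sum has mean at most `Q`, the result is `r⁻¹ * log Q`.
  let Y : S → ℝ := fun ω =>
    r⁻¹ * (Real.log Q - 1 + (∑ c ∈ s, Real.exp (r * |deviation μ X (f c) ω|)) / Q)
  have hsum0 : ∀ ω, 0 ≤ (∑ c ∈ s, Real.exp (r * |deviation μ X (f c) ω|)) / Q := fun ω =>
    div_nonneg (Finset.sum_nonneg fun c _ => (Real.exp_pos _).le) hQ0.le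
  have hYm : Measurable Y := by
    have : Measurable fun ω => ∑ c ∈ s, Real.exp (r * |deviation μ X (f c) ω|) :=
      Finset.measurable_fun_sum s fun c hc => Real.measurable_exp.comp
        ((measurable_deviation hX (hf c hc)).abs.const_mul r)
    exact ((this.div_const Q).const_add _).const_mul _
  refine ⟨Y, hYm, fun c hc ω => ?_, ?_⟩
  · have h1 : r * |deviation μ X (f c) ω| ≤
        Real.log Q - 1 + (∑ c ∈ s, Real.exp (r * |deviation μ X (f c) ω|)) / Q := by
      have h2 : Real.exp (r * |deviation μ X (f c) ω|) ≤
          ∑ c ∈ s, Real.exp (r * |deviation μ X (f c) ω|) :=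
        Finset.single_le_sum (f := fun c => Real.exp (r * |deviation μ X (f c) ω|))
          (fun c _ => (Real.exp_pos _).le) hc
      have h3 := Real.add_one_le_exp (r * |deviation μ X (f c) ω| - Real.log Q)
      rw [Real.exp_sub, Real.exp_log hQ0] at h3
      have h4 := div_le_div_of_nonneg_right h2 hQ0.le
      linarith
    calc |deviation μ X (f c) ω| = r⁻¹ * (r * |deviation μ X (f c) ω|) := by field_simp
      _ ≤ Y ω := mul_le_mul_of_nonneg_left h1 (by positivity)
  · have hYi : Integrable Y P :=
      ((integrable_const _).add ((integrable_finsetSum s hint).div_const Q)).const_mul _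
    have hY0 : ∀ ω, 0 ≤ Y ω := fun ω =>
      mul_nonneg (by positivity) (by linarith [hsum0 ω])
    rw [← ofReal_integral_eq_lintegral_ofReal hYi (Filter.Eventually.of_forall hY0)]
    apply ENNReal.ofReal_le_ofReal
    have h5 : ∫ ω, ∑ c ∈ s, Real.exp (r * |deviation μ X (f c) ω|) ∂P ≤ Q := by
      rw [integral_finsetSum s hint]
      calc _ ≤ ∑ c ∈ s, 2 * Real.exp (1 / 2) := Finset.sum_le_sum fun c hc =>
            integral_exp_abs_deviation_le hn hX hlaw hindep (hf c hc) hb0 (hb c hc)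
        _ = s.card * (2 * Real.exp (1 / 2)) := by rw [Finset.sum_const, nsmul_eq_mul]
        _ ≤ M * (2 * Real.exp (1 / 2)) := by gcongr
        _ = Q := by rw [hQ]; ring
    have h6 : ∫ ω, Y ω ∂P = r⁻¹ * (Real.log Q - 1 +
        (∫ ω, ∑ c ∈ s, Real.exp (r * |deviation μ X (f c) ω|) ∂P) / Q) := by
      simp only [Y]
      rw [integral_const_mul, integral_add (integrable_const _)
        ((integrable_finsetSum s hint).div_const Q), integral_div]
      simp
    have h7 : (∫ ω, ∑ c ∈ s, Real.exp (r * |deviation μ X (f c) ω|) ∂P) / Q ≤ 1 :=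
      (div_le_one hQ0).mpr h5
    rw [h6, ← hlogQ, hr, inv_div]
    gcongr
    linarith

end EmpiricalProcess

/-! ### Dyadic chaining over the parameter cube. -/

section Chaining

variable {ι T : Type*} {θ : T → ι → ℝ}

/-- The dyadic cell of side `2⁻ᵏ` that contains the parameter of `t`. -/
noncomputable def cell (θ : T → ι → ℝ) (k : ℕ) (t : T) (i : ι) : ℤ := ⌊2 ^ k * θ t i⌋

open Classical in
/-- A representative of a dyadic cell. -/
noncomputable def cellRep [Nonempty T] (θ : T → ι → ℝ) (k : ℕ) (c : ι → ℤ) : T :=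
  if h : ∃ t, cell θ k t = c then h.choose else Classical.arbitrary T

lemma cell_cellRep [Nonempty T] (k : ℕ) (t : T) :
    cell θ k (cellRep θ k (cell θ k t)) = cell θ k t := by
  have h : ∃ t', cell θ k t' = cell θ k t := ⟨t, rfl⟩
  rw [cellRep, dif_pos h]
  exact h.choose_spec

/-- Dyadic grids are nested. Hence a cell of level `k + 1` determines its parent, and the links
between two levels are counted by cells of the finer level rather than by pairs. -/
lemma cell_eq_div (k : ℕ) (t : T) (i : ι) : cell θ k t i = cell θ (k + 1) t i / 2 := by
  have := Int.floor_div_natCast (2 ^ (k + 1) * θ t i) 2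
  rw [cell, cell]
  rw [show ((2 : ℤ)) = ((2 : ℕ) : ℤ) from rfl, ← this]
  congr 1
  push_cast
  ring

lemma cell_eq_of_succ {k : ℕ} {t t' : T} (h : cell θ (k + 1) t = cell θ (k + 1) t') :
    cell θ k t = cell θ k t' := by
  funext i
  rw [cell_eq_div, cell_eq_div k t', h]

lemma abs_sub_le_of_cell_eq {k : ℕ} {t t' : T} (h : cell θ k t = cell θ k t') (i : ι) :
    |θ t i - θ t' i| ≤ (1 / 2) ^ k := by
  have h1 : |2 ^ k * θ t i - 2 ^ k * θ t' i| < 1 := Int.abs_sub_lt_one_of_floor_eq_floor (congrFun h i)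
  rw [← mul_sub, abs_mul, abs_of_pos (by positivity)] at h1
  rw [one_div, inv_pow, ← one_div, le_div_iff₀ (by positivity)]
  linarith

/-- The finite set of all cells of side `2⁻ᵏ` that meet the cube. -/
noncomputable def cells (ι : Type*) [Fintype ι] [DecidableEq ι] (k : ℕ) : Finset (ι → ℤ) :=
  Fintype.piFinset fun _ => Finset.Icc (-2 ^ k) (2 ^ k)

lemma cell_mem_cells [Fintype ι] [DecidableEq ι] (hθ : ∀ t i, |θ t i| ≤ 1) (k : ℕ) (t : T) : cell θ k t ∈ cells ι k := by
  rw [cells, Fintype.mem_piFinset]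
  intro i
  have h1 := abs_le.mp (hθ t i)
  have h2 : (0 : ℝ) < 2 ^ k := by positivity
  rw [Finset.mem_Icc]
  constructor
  · rw [cell, Int.le_floor]; push_cast; nlinarith
  · have : (cell θ k t i : ℝ) ≤ 2 ^ k := (Int.floor_le _).trans (by nlinarith)
    exact_mod_cast this

lemma card_cells_le [Fintype ι] [DecidableEq ι] (k : ℕ) : ((cells ι k).card : ℝ) ≤ 2 ^ ((k + 2) * Fintype.card ι) := by
  rw [cells, Fintype.card_piFinset, Finset.prod_const, Finset.card_univ, Int.card_Icc, pow_mul]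
  push_cast
  have h1 : ((2 : ℤ) ^ k + 1 - -2 ^ k).toNat ≤ 2 ^ (k + 2) := by
    rw [Int.toNat_le]
    push_cast
    have : (1 : ℤ) ≤ 2 ^ k := one_le_pow₀ (by norm_num)
    rw [pow_add]; linarith
  have h2 : ((((2 : ℤ) ^ k + 1 - -2 ^ k).toNat : ℕ) : ℝ) ≤ 2 ^ (k + 2) := by exact_mod_cast h1
  gcongr

lemma log_two_mul_pow_le {q N : ℕ} (hN : 1 ≤ N) :
    Real.log (2 * 2 ^ (q * N)) + 1 / 2 ≤ N * (q + 2) := by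
  have hN' : (1 : ℝ) ≤ N := by exact_mod_cast hN
  rw [← pow_succ', Real.log_pow]
  push_cast
  have h1 := Real.log_two_lt_d9
  have h2 : ((q : ℝ) * N + 1) * Real.log 2 ≤ (q * N + 1) * 1 := by gcongr; linarith
  nlinarith

variable {V : Type*} [MeasurableSpace V] {S : Type*} {n : ℕ}
  {μ : Measure V} [IsProbabilityMeasure μ]
  {X : Fin n → S → V} {f : T → V → ℝ} {B K : ℝ}

lemma abs_deviation_sub_le (hn : 1 ≤ n) (hf : ∀ t, Measurable (f t)) (hB : ∀ t x, |f t x| ≤ B)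
    (hK : ∀ t t' p, 0 ≤ p → (∀ i, |θ t i - θ t' i| ≤ p) → ∀ x, |f t x - f t' x| ≤ K * p)
    {k : ℕ} {t t' : T} (h : cell θ k t = cell θ k t') (s : S) :
    |deviation μ X (f t) s - deviation μ X (f t') s| ≤ 2 * (K * (1 / 2) ^ k) := by
  rw [← deviation_sub (integrable_of_abs_le (hf t) (hB t)) (integrable_of_abs_le (hf t') (hB t'))]
  exact abs_deviation_le hn (hK t t' _ (by positivity) (abs_sub_le_of_cell_eq h)) s

lemma tendsto_deviation_cellRep [Nonempty T] (hn : 1 ≤ n) (hf : ∀ t, Measurable (f t))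
    (hB : ∀ t x, |f t x| ≤ B)
    (hK : ∀ t t' p, 0 ≤ p → (∀ i, |θ t i - θ t' i| ≤ p) → ∀ x, |f t x - f t' x| ≤ K * p)
    (t : T) (s : S) :
    Filter.Tendsto (fun k => ENNReal.ofReal |deviation μ X (f (cellRep θ k (cell θ k t))) s|)
      Filter.atTop (nhds (ENNReal.ofReal |deviation μ X (f t) s|)) := by
  refine (ENNReal.continuous_ofReal.tendsto _).comp ?_
  refine (continuous_abs.tendsto _).comp ?_
  rw [tendsto_iff_dist_tendsto_zero]
  have h0 : Filter.Tendsto (fun k : ℕ => 2 * (K * (1 / 2 : ℝ) ^ k)) Filter.atTop (nhds 0) := by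
    have := tendsto_pow_atTop_nhds_zero_of_lt_one (r := (1 / 2 : ℝ)) (by norm_num) (by norm_num)
    simpa using (this.const_mul K).const_mul 2
  refine squeeze_zero (fun _ => dist_nonneg) (fun k => ?_) h0
  exact abs_deviation_sub_le hn hf hB hK (cell_cellRep k t) s

variable [MeasurableSpace S] {P : Measure S} [IsProbabilityMeasure P]

/-- Deviations at cell representatives converge to the deviation at the given parameter, so the
supremum over a possibly uncountable class equals one over countably many representatives. -/
lemma measurable_iSup_deviation [Finite ι] [Nonempty T] (hn : 1 ≤ n) (hX : ∀ i, Measurable (X i))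
    (hf : ∀ t, Measurable (f t)) (hB : ∀ t x, |f t x| ≤ B)
    (hK : ∀ t t' p, 0 ≤ p → (∀ i, |θ t i - θ t' i| ≤ p) → ∀ x, |f t x - f t' x| ≤ K * p) :
    Measurable fun s => ⨆ t, ENNReal.ofReal |deviation μ X (f t) s| := by
  have h1 : (fun s => ⨆ t, ENNReal.ofReal |deviation μ X (f t) s|) =
      fun s => ⨆ q : ℕ × (ι → ℤ), ENNReal.ofReal |deviation μ X (f (cellRep θ q.1 q.2)) s| := by
    funext s
    apply le_antisymm
    · refine iSup_le fun t => le_of_tendsto (tendsto_deviation_cellRep hn hf hB hK t s)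
        (Filter.Eventually.of_forall fun k => ?_)
      exact le_iSup (fun q : ℕ × (ι → ℤ) =>
        ENNReal.ofReal |deviation μ X (f (cellRep θ q.1 q.2)) s|) (k, cell θ k t)
    · exact iSup_le fun q => le_iSup (fun t => ENNReal.ofReal |deviation μ X (f t) s|) _
  rw [h1]
  exact Measurable.iSup fun q => ENNReal.measurable_ofReal.comp
    (measurable_deviation hX (hf _)).abs

/-- **Chaining bound** for the empirical process of a bounded class of functions that depend in a
Lipschitz way on finitely many parameters in `[-1, 1]`. -/
theorem lintegral_iSup_deviation_le [Fintype ι] [Nonempty T] [Nonempty ι] (hn : 1 ≤ n)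
    (hX : ∀ i, Measurable (X i)) (hlaw : ∀ i, P.map (X i) = μ) (hindep : iIndepFun X P)
    (hθ : ∀ t i, |θ t i| ≤ 1) (hf : ∀ t, Measurable (f t)) (hB0 : 0 < B) (hK0 : 0 < K)
    (hB : ∀ t x, |f t x| ≤ B)
    (hK : ∀ t t' p, 0 ≤ p → (∀ i, |θ t i - θ t' i| ≤ p) → ∀ x, |f t x - f t' x| ≤ K * p) :
    ∫⁻ s, ⨆ t, ENNReal.ofReal |deviation μ X (f t) s| ∂P ≤
      ENNReal.ofReal (Fintype.card ι * (4 * B + 14 * K) / Real.sqrt n) := by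
  classical
  set N := Fintype.card ι with hN
  have hN1 : 1 ≤ N := Fintype.card_pos
  have hn' : (0 : ℝ) < n := by exact_mod_cast hn
  have hsq : 0 < Real.sqrt n := Real.sqrt_pos.mpr hn'
  have hpow : ∀ q : ℕ, (1 : ℝ) ≤ 2 ^ (q * N) := fun q => one_le_pow₀ (by norm_num)
  obtain ⟨Y, hYm, hY, hYint⟩ := exists_majorant_deviation (μ := μ) (P := P) hn hX hlaw hindep
    (cells ι 0) (f := fun c => f (cellRep θ 0 c)) (fun c _ => hf _) hB0 (fun c _ => hB _)
    (card_cells_le 0) (hpow _)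
  let link : ℕ → (ι → ℤ) → T := fun k c => cellRep θ (k + 1) c
  -- Increments from a representative to that of its parent cell: two parameters in a common cell of
  -- side `2⁻ᵏ` give functions at distance at most `K * 2⁻ᵏ`.
  have hZ := fun k : ℕ => exists_majorant_deviation (μ := μ) (P := P) hn hX hlaw hindep
    (cells ι (k + 1))
    (f := fun c x => f (link k c) x - f (cellRep θ k (cell θ k (link k c))) x)
    (fun c _ => (hf _).sub (hf _)) (b := K * (1 / 2) ^ k) (by positivity)
    (fun c _ x => hK _ _ _ (by positivity) (abs_sub_le_of_cell_eq (cell_cellRep k _).symm) x)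
    (card_cells_le (k + 1)) (hpow _)
  choose Z hZm hZ hZint using hZ
  have hchain : ∀ t s k, ENNReal.ofReal |deviation μ X (f (cellRep θ k (cell θ k t))) s| ≤
      ENNReal.ofReal (Y s) + ∑ j ∈ Finset.range k, ENNReal.ofReal (Z j s) := by
    intro t s k
    induction k with
    | zero => simpa using ENNReal.ofReal_le_ofReal (hY _ (cell_mem_cells hθ 0 t) s)
    | succ k ih =>
      have h1 := hZ k _ (cell_mem_cells hθ (k + 1) t) s
      rw [deviation_sub (integrable_of_abs_le (hf _) (hB _))
        (integrable_of_abs_le (hf _) (hB _))] at h1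
      have h2 : cell θ k (link k (cell θ (k + 1) t)) = cell θ k t :=
        cell_eq_of_succ (cell_cellRep (k + 1) t)
      rw [h2] at h1
      rw [Finset.sum_range_succ, ← add_assoc]
      refine le_trans ?_ (add_le_add ih (ENNReal.ofReal_le_ofReal h1))
      rw [← ENNReal.ofReal_add (abs_nonneg _) (abs_nonneg _)]
      apply ENNReal.ofReal_le_ofReal
      have h3 := abs_sub_abs_le_abs_sub (deviation μ X (f (link k (cell θ (k + 1) t))) s)
        (deviation μ X (f (cellRep θ k (cell θ k t))) s)
      simp only [link] at h3 ⊢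
      linarith
  have hsup : ∀ s, ⨆ t, ENNReal.ofReal |deviation μ X (f t) s| ≤
      ENNReal.ofReal (Y s) + ∑' j, ENNReal.ofReal (Z j s) := fun s =>
    iSup_le fun t => le_of_tendsto (tendsto_deviation_cellRep hn hf hB hK t s)
      (Filter.Eventually.of_forall fun k =>
        (hchain t s k).trans (add_le_add le_rfl (ENNReal.sum_le_tsum _)))
  -- There are at most `2 ^ ((j + 3) * N)` links at level `j`, so level `j` costs at most `K * 2⁻ʲ *
  -- N * (j + 5) / √n`. The series sums to `2 + 5 * 2 = 12` times `K * N / √n`.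
  have hg1 : HasSum (fun j : ℕ => (j : ℝ) * (1 / 2) ^ j) 2 := by
    have := hasSum_coe_mul_geometric_of_norm_lt_one (r := (1 / 2 : ℝ)) (by norm_num)
    norm_num at this ⊢
    exact this
  have hg : HasSum (fun j : ℕ => K * N / Real.sqrt n * ((j : ℝ) * (1 / 2) ^ j + 5 * (1 / 2) ^ j))
      (K * N / Real.sqrt n * (2 + 5 * 2)) :=
    (hg1.add (hasSum_geometric_two.mul_left 5)).mul_left _
  calc ∫⁻ s, ⨆ t, ENNReal.ofReal |deviation μ X (f t) s| ∂P
      ≤ ∫⁻ s, (ENNReal.ofReal (Y s) + ∑' j, ENNReal.ofReal (Z j s)) ∂P := lintegral_mono hsup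
    _ = ∫⁻ s, ENNReal.ofReal (Y s) ∂P + ∑' j, ∫⁻ s, ENNReal.ofReal (Z j s) ∂P := by
      rw [lintegral_add_left hYm.ennreal_ofReal,
        lintegral_tsum fun j => (hZm j).ennreal_ofReal.aemeasurable]
    _ ≤ ENNReal.ofReal (B / Real.sqrt n * (N * 4)) + ∑' j : ℕ, ENNReal.ofReal
          (K * N / Real.sqrt n * ((j : ℝ) * (1 / 2) ^ j + 5 * (1 / 2) ^ j)) := by
      refine add_le_add (hYint.trans (ENNReal.ofReal_le_ofReal ?_))
        (ENNReal.tsum_le_tsum fun j => (hZint j).trans (ENNReal.ofReal_le_ofReal ?_))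
      · have := log_two_mul_pow_le (q := 0 + 2) hN1
        norm_num at this ⊢
        gcongr
      · have := log_two_mul_pow_le (q := j + 1 + 2) hN1
        push_cast at this
        calc _ ≤ K * (1 / 2) ^ j / Real.sqrt n * (N * ((j : ℝ) + 1 + 2 + 2)) := by gcongr
          _ = _ := by ring
    _ = ENNReal.ofReal (B / Real.sqrt n * (N * 4)) +
          ENNReal.ofReal (K * N / Real.sqrt n * (2 + 5 * 2)) := by
      rw [← ENNReal.ofReal_tsum_of_nonneg (fun j => by positivity) hg.summable, hg.tsum_eq]
    _ ≤ _ := by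
      rw [← ENNReal.ofReal_add (by positivity) (by positivity)]
      apply ENNReal.ofReal_le_ofReal
      have h1 : 0 ≤ K * N / Real.sqrt n := by positivity
      calc _ = N * (4 * B + 12 * K) / Real.sqrt n := by ring
        _ ≤ _ := by gcongr; norm_num

end Chaining

/-! ### The Jacobian of the flow as continuous density. -/

section Density

variable {d m : ℕ} {η : Vec d → ℝ → Vec d} {D : Vec d → ℝ → Vec d →L[ℝ] Vec d} {S G h : ℝ}

lemma measurableSet_dom : MeasurableSet (dom d) := measurableSet_ball

lemma unif_eq : unif d = (volume (dom d))⁻¹ • (volume.restrict (dom d)) := rfl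

lemma volume_dom_ne_top : volume (dom d) ≠ ∞ := measure_ball_lt_top.ne

/-- Densities agree almost everywhere, and continuous functions that agree almost everywhere on an
open set agree on all of it. So the version chosen by `density` can be computed from any explicit
one. -/
lemma IsContDensity.eqOn {ν : Measure (Vec d)} {f g : Vec d → ℝ} [IsProbabilityMeasure ν]
    (hf : IsContDensity ν f) (hg : IsContDensity ν g) : EqOn f g (dom d) := by
  have hc : (volume (dom d))⁻¹ ≠ 0 := ENNReal.inv_ne_zero.mpr volume_dom_ne_top
  have hae : ∀ {u : Vec d → ℝ}, ContinuousOn u (dom d) →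
      AEMeasurable (fun x => ENNReal.ofReal (u x)) (unif d) := fun hu => by
    rw [unif_eq]
    exact ((hu.aemeasurable measurableSet_dom).ennreal_ofReal).smul_measure _
  have h1 : ∫⁻ x, ENNReal.ofReal (f x) ∂(unif d) ≠ ∞ := by
    have := hf.2.2 ▸ measure_ne_top ν univ
    rwa [withDensity_apply _ MeasurableSet.univ, Measure.restrict_univ] at this
  have h2 := (withDensity_eq_iff (hae hf.1) (hae hg.1) h1).mp (hf.2.2.symm.trans hg.2.2)
  rw [unif_eq, Filter.EventuallyEq, Measure.ae_ennreal_smul_measure_iff hc] at h2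
  have h3 : f =ᵐ[volume.restrict (dom d)] g := by
    filter_upwards [h2, ae_restrict_mem measurableSet_dom] with x hx hxd
    exact (ENNReal.ofReal_eq_ofReal_iff (hf.2.1 x hxd) (hg.2.1 x hxd)).mp hx
  exact Measure.eqOn_open_of_ae_eq h3 Metric.isOpen_ball hf.1 hg.1

lemma IsContDensity.isContDensity_density {ν : Measure (Vec d)} {f : Vec d → ℝ}
    (hf : IsContDensity ν f) : IsContDensity ν (density ν) := by
  have h : ∃ f, IsContDensity ν f := ⟨f, hf⟩
  rw [density, dif_pos h]
  exact h.choose_spec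

lemma bijOn_rkIter (hs : ∀ k < m, BijOn (rkStep h η (k * h)) (dom d) (dom d)) :
    ∀ k ≤ m, BijOn (rkIter h η k) (dom d) (dom d)
  | 0, _ => bijOn_id _
  | k + 1, hk => (hs k hk).comp (bijOn_rkIter hs k (by omega))

lemma FieldBound.continuous (hη : FieldBound η D S G) (t : ℝ) : Continuous fun y => η y t :=
  continuous_iff_continuousAt.mpr fun y => (hη.hasFDerivAt y t).continuousAt

lemma FieldBound.continuous_rkIter (hη : FieldBound η D S G) :
    ∀ k, Continuous (rkIter h η k)
  | 0 => continuous_id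
  | k + 1 => (continuous_iff_continuousAt.mpr fun y =>
      (hη.hasFDerivAt_rkStep h (k * h) y).continuousAt).comp (hη.continuous_rkIter k)

lemma FieldBound.continuous_rkSlope (hη : FieldBound η D S G) (t : ℝ) :
    Continuous (rkSlope h η D t) := by
  have h1 := hη.continuous t
  have h2 := hη.continuous_deriv t
  have h3 := hη.continuous_deriv (t + h / 2)
  have h4 : Continuous (rkMid h η t) := by unfold rkMid; fun_prop
  have h5 := h3.comp h4
  exact Continuous.mul h5 (Continuous.add continuous_const (h2.const_smul (h / 2)))

lemma FieldBound.continuousOn_logJac (hη : FieldBound η D S G) (hh : StepBound h S G)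
    (hm : m * h ≤ 1) (hs : StepsMapTo h η m) : ContinuousOn (logJac h η D m) (dom d) := by
  refine continuousOn_finsetSum _ fun j hj => ContinuousOn.log ?_ fun x hx => ?_
  · have h1 : Continuous fun x => 1 + h • rkSlope h η D (j * h) (rkIter h η j x) :=
      continuous_const.add
        (((hη.continuous_rkSlope (j * h)).comp (hη.continuous_rkIter j)).const_smul h)
    exact (ContinuousLinearMap.continuous_det.comp h1).continuousOn
  · have hjm := Finset.mem_range.mp hj
    obtain ⟨ht, ht'⟩ := hh.time_mem hm hjm
    exact det_one_add_ne_zero (hη.norm_smul_rkSlope_le hh ht ht'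
      (norm_le_of_mem_dom (hs.rkIter_mem hx j hjm.le)))

/-- The pull-back of the uniform distribution under the discretized flow has the Jacobian of the
flow as a continuous density. -/
lemma FieldBound.isContDensity_logJac (hη : FieldBound η D S G) (hh : StepBound h S G)
    (hm : m * h ≤ 1) (hs : ∀ k < m, BijOn (rkStep h η (k * h)) (dom d) (dom d))
    {ν : Measure (Vec d)} [IsProbabilityMeasure ν]
    (hν : ν = (unif d).map (Function.invFunOn (rkIter h η m) (dom d))) :
    IsContDensity ν fun x => Real.exp (logJac h η D m x) := by
  have hmaps : StepsMapTo h η m := fun k hk => (hs k hk).mapsTo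
  have hbij := bijOn_rkIter hs m le_rfl
  refine ⟨(hη.continuousOn_logJac hh hm hmaps).rexp, fun x _ => (Real.exp_pos _).le, ?_⟩
  -- `Measure.map` along a map that is not a.e.-measurable is `0`, which is not a probability
  -- measure; measurability of the inverse thus comes for free.
  have hmeas : AEMeasurable (Function.invFunOn (rkIter h η m) (dom d)) (unif d) := by
    by_contra hna
    rw [Measure.map_of_not_aemeasurable hna] at hν
    exact IsProbabilityMeasure.ne_zero ν hν
  choose! T hT hTd using fun x (hx : x ∈ dom d) => hη.exp_logJac hh hm hmaps hx m le_rfl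
  ext A hA
  -- Preimages under the inverse are images under the flow, so the change of variables needs only
  -- the differentiable forward map.
  have hset : Function.invFunOn (rkIter h η m) (dom d) ⁻¹' A ∩ dom d =
      rkIter h η m '' (A ∩ dom d) := by
    ext y
    constructor
    · rintro ⟨hyA, hy⟩
      exact ⟨_, ⟨hyA, hbij.surjOn.mapsTo_invFunOn hy⟩, hbij.surjOn.rightInvOn_invFunOn hy⟩
    · rintro ⟨x, ⟨hxA, hx⟩, rfl⟩
      refine ⟨?_, hbij.mapsTo hx⟩
      rw [mem_preimage, hbij.injOn.leftInvOn_invFunOn hx]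
      exact hxA
  have hvol : volume (rkIter h η m '' (A ∩ dom d)) =
      ∫⁻ x in A ∩ dom d, ENNReal.ofReal (Real.exp (logJac h η D m x)) := by
    rw [← lintegral_abs_det_fderiv_eq_addHaar_image volume (hA.inter measurableSet_dom)
      (fun x hx => (hT x hx.2).hasFDerivWithinAt) (hbij.injOn.mono inter_subset_right)]
    exact setLIntegral_congr_fun (hA.inter measurableSet_dom) fun x hx => by
      rw [hTd x hx.2]
  rw [hν, Measure.map_apply_of_aemeasurable hmeas hA, withDensity_apply _ hA, unif_eq,
    Measure.smul_apply, Measure.restrict_apply' measurableSet_dom, hset, hvol,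
    Measure.restrict_smul, lintegral_smul_measure, Measure.restrict_restrict hA]

end Density

/-! ### The radii as growth bounds for the layers. -/

section Constants

variable {W L : ℕ}

lemma radius_zero_sq (W : ℕ) : radius W 0 ^ 2 = 5 / 4 := by
  rw [radius, Real.sq_sqrt (by norm_num)]; norm_num

lemma one_le_radius (hW : 1 ≤ W) : ∀ l, 1 ≤ radius W l
  | 0 => by
    rw [radius, Real.one_le_sqrt]; norm_num
  | l + 1 => by
    have h1 : (1 : ℝ) ≤ W := by exact_mod_cast hW
    have h2 := one_le_radius hW l
    rw [radius]
    exact one_le_mul_of_one_le_of_one_le (one_le_pow₀ (by linarith)) (one_le_pow₀ h2)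

lemma monotone_radius (hW : 1 ≤ W) : Monotone (radius W) := by
  refine monotone_nat_of_le_succ fun l => ?_
  have h1 : (1 : ℝ) ≤ W := by exact_mod_cast hW
  have h2 := one_le_radius hW l
  have h3 : (1 : ℝ) ≤ (2 * W) ^ 2 := one_le_pow₀ (by linarith)
  rw [radius]
  nlinarith

lemma le_radius_succ (hW : 1 ≤ W) (l : ℕ) : 5 * (W : ℝ) ^ 2 ≤ radius W (l + 1) := by
  refine le_trans (le_of_eq ?_) (monotone_radius hW (show 1 ≤ l + 1 by omega))
  rw [radius, radius_zero_sq]; ring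

/-- With `r` the radius at level `l + 1`, the bound for level `l` gives `actBound W (l + 1) ≤ 2 * W
* r`, and `(2 * W * r) ^ 2` is the next radius. The factor `2` leaves room for the `+ 1`, since `2 *
W * r ≥ 10`. -/
lemma actBound_add_one_sq_le (hW : 1 ≤ W) :
    ∀ l, (actBound W l + 1) ^ 2 ≤ 2 * radius W (l + 1)
  | 0 => by
    have h1 : (1 : ℝ) ≤ W := by exact_mod_cast hW
    rw [actBound, radius, radius_zero_sq]
    nlinarith
  | l + 1 => by
    have h1 : (1 : ℝ) ≤ W := by exact_mod_cast hW
    have ih := actBound_add_one_sq_le hW l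
    have h2 := le_radius_succ hW l
    set r := radius W (l + 1) with hr
    have h3 : actBound W (l + 1) + 1 ≤ 2 * W * r + 1 := by
      rw [actBound]; nlinarith
    have h4 : 0 ≤ actBound W (l + 1) := actBound_nonneg W _
    have h5 : 10 ≤ 2 * W * r := by nlinarith
    calc (actBound W (l + 1) + 1) ^ 2 ≤ (2 * W * r + 1) ^ 2 := by gcongr
      _ ≤ 2 * (2 * W * r) ^ 2 := by nlinarith
      _ = 2 * radius W (l + 1 + 1) := by rw [radius, ← hr]; ring

lemma actBound_le_radius (hW : 1 ≤ W) : ∀ l, actBound W l ≤ 2 * W * radius W l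
  | 0 => by
    have h1 := one_le_radius hW 0
    rw [actBound]
    exact le_mul_of_one_le_right (by positivity) h1
  | l + 1 => by
    have h1 := actBound_add_one_sq_le hW l
    rw [actBound]
    calc (W : ℝ) * (actBound W l + 1) ^ 2 ≤ W * (2 * radius W (l + 1)) := by gcongr
      _ = _ := by ring

lemma growthBound_radius (hW : 1 ≤ W) (M : ℕ) : GrowthBound W M ((2 * W) ^ 2 * radius W M) where
  growth l hl := by
    have h1 : (1 : ℝ) ≤ W := by exact_mod_cast hW
    have h2 := le_radius_succ hW l
    have h3 : radius W (l + 1) ≤ radius W M := monotone_radius hW hl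
    have h4 := actBound_add_one_sq_le hW l
    set ρ := radius W M
    have h5 : 5 * (W : ℝ) ^ 2 ≤ ρ := h2.trans h3
    have h0 : 0 ≤ ρ := (by positivity : 0 ≤ 5 * (W : ℝ) ^ 2).trans h5
    -- The available bound is on squares. Here `(A / 3) ^ 2 = 16 / 9 * W ^ 4 * ρ ^ 2`, and one
    -- factor `ρ` is traded for `5 * W ^ 2`, whence `80 / 9`.
    refine le_of_sq_le_sq ?_ (by positivity)
    have h6 : (1 : ℝ) ≤ W ^ 4 := one_le_pow₀ h1
    calc (2 * W * (actBound W l + 1)) ^ 2 = 4 * W ^ 2 * (actBound W l + 1) ^ 2 := by ring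
      _ ≤ 4 * W ^ 2 * (2 * ρ) := by gcongr; linarith
      _ ≤ 80 / 9 * (W ^ 2 * ρ * W ^ 4) := by
        have : 0 ≤ W ^ 2 * ρ := by positivity
        nlinarith
      _ = 16 / 9 * W ^ 4 * ρ * (5 * W ^ 2) := by ring
      _ ≤ 16 / 9 * W ^ 4 * ρ * ρ := by gcongr
      _ = _ := by ring
  sq_le := by
    have h1 := one_le_radius hW M
    nlinarith [sq_nonneg (W : ℝ)]
  out_le := by
    have h1 := actBound_le_radius hW M
    calc (W : ℝ) * actBound W M ≤ W * (2 * W * radius W M) := by gcongr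
      _ = _ := by ring
  one_le_W := hW

end Constants

/-! ### Embedding networks of all admissible widths into one cube. -/

section Padding

variable {d L : ℕ} {ℓ : ℕ → ℕ}

/-- The parameters of a network, extended by zero to the index ranges of `Net`. -/
noncomputable def Params.toNet (θ : Params d L ℓ) : Net where
  weight l i k :=
    if l < L - 1 then
      if h : i < ℓ l ∧ k < size d ℓ l then θ.weight l ⟨i, h.1⟩ ⟨k, h.2⟩ else 0
    else if l = L - 1 then
      if h : i < d ∧ k < size d ℓ (L - 1) then θ.out ⟨i, h.1⟩ ⟨k, h.2⟩ else 0
    else 0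
  bias l i := if l < L - 1 then if h : i < ℓ l then θ.bias l ⟨i, h⟩ else 0 else 0

/-- All entries vanish outside of the first `L` layers, `W` rows and `W + 1` columns. -/
def Net.IsSupported (N : Net) (L W : ℕ) : Prop :=
  (∀ l i k, ¬(l < L ∧ i < W ∧ k < W + 1) → N.weight l i k = 0) ∧
  ∀ l i, ¬(l < L ∧ i < W) → N.bias l i = 0

lemma Params.InCube.isBounded_toNet {θ : Params d L ℓ} (hθ : θ.InCube) : θ.toNet.IsBounded := by
  refine ⟨fun l i k => ?_, fun l i => ?_⟩
  · simp only [Params.toNet]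
    split_ifs
    exacts [abs_le.mpr (hθ.1 _ _ _), by simp, abs_le.mpr (hθ.2.2 _ _), by simp, by simp]
  · simp only [Params.toNet]
    split_ifs
    exacts [abs_le.mpr (hθ.2.1 _ _), by simp, by simp]

lemma size_le_fanIn {W : ℕ} (hℓ : ∀ i, ℓ i ≤ W) : ∀ l, size d ℓ l ≤ fanIn d W l
  | 0 => le_rfl
  | l + 1 => hℓ l

lemma fanIn_le {W : ℕ} (hdW : d ≤ W) : ∀ l, fanIn d W l ≤ W + 1
  | 0 => by simp [fanIn, hdW]
  | l + 1 => by simp [fanIn]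

lemma Params.isSupported_toNet {W : ℕ} (θ : Params d L ℓ) (hL : 1 ≤ L) (hdW : d ≤ W)
    (hℓ : ∀ i, ℓ i ≤ W) : θ.toNet.IsSupported L W := by
  have hs : ∀ l, size d ℓ l ≤ W + 1 := fun l => (size_le_fanIn hℓ l).trans (fanIn_le hdW l)
  refine ⟨fun l i k h => ?_, fun l i h => ?_⟩
  · simp only [Params.toNet]
    have h1 := hs l
    have h2 := hs (L - 1)
    have h3 := hℓ l
    split_ifs with h4 h5 h5 h6
    exacts [absurd ⟨by omega, by omega, by omega⟩ h, rfl,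
      absurd ⟨by omega, by omega, by omega⟩ h, rfl, rfl]
  · simp only [Params.toNet]
    have h3 := hℓ l
    split_ifs with h4 h5
    exacts [absurd ⟨by omega, by omega⟩ h, rfl, rfl]

lemma sum_range_fanIn_eq {W : ℕ} (hℓ : ∀ i, ℓ i ≤ W) (l : ℕ) {c v : ℕ → ℝ}
    (hc : ∀ k, size d ℓ l ≤ k → c k = 0) :
    ∑ k ∈ Finset.range (fanIn d W l), c k * v k = ∑ k : Fin (size d ℓ l), c k * v k := by
  rw [Fin.sum_univ_eq_sum_range (fun k => c k * v k) (size d ℓ l)]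
  refine (Finset.sum_subset (Finset.range_subset_range.mpr (size_le_fanIn hℓ l)) ?_).symm
  intro k _ hk
  rw [hc k (by simpa using hk), zero_mul]

/-- Columns beyond the true size of a layer have weight zero, so the values carried by padded units
never matter. -/
lemma Params.act_toNet {W : ℕ} (θ : Params d L ℓ) (hℓ : ∀ i, ℓ i ≤ W) {z : ℕ → ℝ}
    {x : Fin (d + 1) → ℝ} (hz : ∀ i : Fin (d + 1), z i = x i) :
    ∀ l ≤ L - 1, ∀ i : Fin (size d ℓ l), θ.toNet.act d W z l i = θ.hidden x l i
  | 0, _, i => hz i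
  | l + 1, hl, i => by
    have ih := θ.act_toNet hℓ hz l (by omega)
    have hi : (i : ℕ) < ℓ l := i.2
    have hl' : l < L - 1 := hl
    simp only [Net.act, Params.hidden, layer]
    rw [sum_range_fanIn_eq hℓ l]
    · congr 2
      · refine Finset.sum_congr rfl fun k _ => ?_
        rw [ih k]
        simp only [Params.toNet, hl', hi, k.2, if_true, and_self, dite_true]
        rfl
      · simp only [Params.toNet, hl', hi, if_true, dite_true]
        rfl
    · intro k hk
      simp only [Params.toNet, hl', if_true]
      rw [dif_neg (by omega)]

lemma Params.field_toNet {W : ℕ} (θ : Params d L ℓ) (hℓ : ∀ i, ℓ i ≤ W) :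
    θ.toNet.field d W (L - 1) = θ.field := by
  funext y t
  ext j
  have hz : ∀ i : Fin (d + 1), netInput y t i =
      (Fin.snoc (α := fun _ => ℝ) (fun i => y i) t : Fin (d + 1) → ℝ) i := by
    intro i
    simp only [netInput, Fin.snoc]
    rfl
  have h1 : (θ.toNet.field d W (L - 1) y t) j = ∑ k ∈ Finset.range (fanIn d W (L - 1)),
      θ.toNet.weight (L - 1) j k * θ.toNet.act d W (netInput y t) (L - 1) k := by
    simp [Net.field, Finset.sum_apply, Pi.single_apply]
  rw [h1, sum_range_fanIn_eq hℓ]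
  · simp only [Params.field, layer, Matrix.mulVec, dotProduct, Pi.add_apply, id, Pi.zero_apply,
      add_zero]
    refine Finset.sum_congr rfl fun k _ => ?_
    rw [θ.act_toNet hℓ hz (L - 1) le_rfl k]
    simp [Params.toNet]
  · intro k hk
    simp only [Params.toNet, lt_irrefl, if_false, if_true]
    rw [dif_neg (by omega)]

/-- The finitely many entries of a network that is supported in `L` layers of width `W`. -/
def Net.coord (N : Net) (L W : ℕ) (q : Fin L × Fin W × Fin (W + 2)) : ℝ :=
  if (q.2.2 : ℕ) < W + 1 then N.weight q.1 q.2.1 q.2.2 else N.bias q.1 q.2.1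

lemma Net.IsBounded.abs_coord_le {N : Net} (hN : N.IsBounded) (L W : ℕ)
    (q : Fin L × Fin W × Fin (W + 2)) : |N.coord L W q| ≤ 1 := by
  unfold Net.coord
  split_ifs
  exacts [hN.1 _ _ _, hN.2 _ _]

/-- Outside the support both networks vanish, so finitely many coordinates control all entries. The
last index ranges over `W + 2` values: `W + 1` columns, to fit the `d + 1` inputs of the first
layer, and one slot for the bias. -/
lemma Net.IsSupported.within {N N' : Net} {L W : ℕ} (hN : N.IsSupported L W)
    (hN' : N'.IsSupported L W) {p : ℝ} (hp : 0 ≤ p)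
    (h : ∀ q, |N.coord L W q - N'.coord L W q| ≤ p) : N.Within N' p := by
  refine ⟨fun l i k => ?_, fun l i => ?_⟩
  · by_cases hr : l < L ∧ i < W ∧ k < W + 1
    · have := h (⟨l, hr.1⟩, ⟨i, hr.2.1⟩, ⟨k, by omega⟩)
      simpa [Net.coord, hr.2.2] using this
    · rw [hN.1 l i k hr, hN'.1 l i k hr]; simpa using hp
  · by_cases hr : l < L ∧ i < W
    · have := h (⟨l, hr.1⟩, ⟨i, hr.2⟩, ⟨W + 1, by omega⟩)
      simpa [Net.coord] using this
    · rw [hN.2 l i hr, hN'.2 l i hr]; simpa using hp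

end Padding

/-! ### Absorbing all constants into `lam` and `lamZ`. -/

section Constants

variable {d L W m : ℕ}

/-- The bound `(2W)² R_{L-1}` for the growth of a single layer. -/
noncomputable def layerGrowth (L W : ℕ) : ℝ := (2 * W) ^ 2 * radius W (L - 1)

lemma lam_eq (hL : 1 ≤ L) : lam L W = layerGrowth L W ^ (L - 1 + 1) := by
  rw [lam, layerGrowth, Nat.sub_add_cancel hL]

lemma layerGrowth_le_lam (hL : 1 ≤ L) (hW : 1 ≤ W) : layerGrowth L W ≤ lam L W := by
  rw [lam_eq hL]
  exact le_self_pow₀ (growthBound_radius hW _).one_le (by omega)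

lemma four_le_layerGrowth (hW : 1 ≤ W) : 4 ≤ layerGrowth L W := by
  have h1 : (1 : ℝ) ≤ W ^ 2 := one_le_pow₀ (by exact_mod_cast hW)
  have := (growthBound_radius hW (L - 1)).sq_le
  rw [layerGrowth]; linarith

lemma deriv_bound_le (hL : 1 ≤ L) (hW : 1 ≤ W) :
    W ^ 2 * layerGrowth L W ^ (L - 1) ≤ lam L W / 4 := by
  have h1 := (growthBound_radius hW (L - 1)).sq_le
  have h4 := four_le_layerGrowth (L := L) hW
  change 4 * (W : ℝ) ^ 2 ≤ layerGrowth L W at h1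
  rw [lam_eq hL, pow_succ (layerGrowth L W)]
  have : 0 ≤ layerGrowth L W ^ (L - 1) := by positivity
  nlinarith

/-- The step-size condition says that `h * lam < 1 / 2`. The field is bounded by at most `lam / 2`
and its derivative by at most `lam / 4`, which gives the thresholds `1 / 4` and `1 / 8`. -/
lemma stepBound_of_lt (hL : 1 ≤ L) (hW : 1 ≤ W) (hm : 1 ≤ m)
    (hstep : (1 / m : ℝ) < 1 / (2 * lam L W)) :
    StepBound (1 / m) (layerGrowth L W / 2) (W ^ 2 * layerGrowth L W ^ (L - 1)) := by
  have h4 := four_le_layerGrowth (L := L) hW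
  have h5 := layerGrowth_le_lam hL hW
  have h0 : 0 < lam L W := by linarith
  have hm' : (1 : ℝ) ≤ m := by exact_mod_cast hm
  have h6 : (1 / m : ℝ) * lam L W ≤ 1 / 2 := by
    rw [lt_div_iff₀ (by positivity)] at hstep
    linarith
  refine ⟨by positivity, by rw [div_le_one (by positivity)]; exact hm', ?_, ?_, by positivity⟩
  · calc (1 / m : ℝ) * (layerGrowth L W / 2) ≤ 1 / m * (lam L W / 2) := by gcongr
      _ ≤ 1 / 4 := by linarith
  · calc (1 / m : ℝ) * (W ^ 2 * layerGrowth L W ^ (L - 1)) ≤ 1 / m * (lam L W / 4) := by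
          gcongr
          exact deriv_bound_le hL hW
      _ ≤ 1 / 8 := by linarith

/-- The base of the power is at least `1`, and the estimates need only its first power. -/
lemma le_lamZ (hd : 1 ≤ d) (hL : 1 ≤ L) (hW : 1 ≤ W) :
    8 * d * lam L W ^ 5 * Real.exp (lam L W) ≤ lamZ d L W := by
  have h1 : 4 ≤ lam L W := (four_le_layerGrowth hW).trans (layerGrowth_le_lam hL hW)
  have h2 : (1 : ℝ) ≤ d := by exact_mod_cast hd
  refine le_self_pow₀ ?_ (by omega)
  refine one_le_mul_of_one_le_of_one_le (one_le_mul_of_one_le_of_one_le (by linarith)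
    (one_le_pow₀ (by linarith))) (Real.one_le_exp (by linarith))

/-- The left side is the constant of `FieldClose.abs_logJac_sub_le` at the values supplied by
`GrowthBound.fieldClose`. Each polynomial factor is at most a multiple of `Λ ^ 2`, so the total is
at most `23 / 3 * d * Λ ^ 4 * exp Λ`; the fifth power of `Λ`, with `Λ ≥ 4`, absorbs the numerical
constant. -/
lemma lipschitz_bound_le (hd : 1 ≤ d) (hL : 1 ≤ L) (hW : 1 ≤ W) {p : ℝ} (hp : 0 ≤ p) :
    d * (8 / 3) * (3 * W ^ 2 * layerGrowth L W ^ (2 * (L - 1)) *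
      (5 * (W * (layerGrowth L W ^ (L - 1 + 1) + layerGrowth L W) * p) *
        Real.exp (2 * (W ^ 2 * layerGrowth L W ^ (L - 1)))) +
      (3 * W * layerGrowth L W ^ (2 * (L - 1) + 1) + W ^ 2 * layerGrowth L W ^ (L - 1)) * p) ≤
    lamZ d L W / 4 * p := by
  have hG := deriv_bound_le hL hW
  have hAB := growthBound_radius hW (L - 1)
  have hsq := hAB.sq_le
  have hWA := hAB.W_le
  have hAΛ := layerGrowth_le_lam hL hW
  have hA4 := four_le_layerGrowth (L := L) hW
  have hlam := lam_eq (W := W) hL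
  have hZ := le_lamZ hd hL hW
  change 4 * (W : ℝ) ^ 2 ≤ layerGrowth L W at hsq
  change (W : ℝ) ≤ layerGrowth L W / 4 at hWA
  have hW1 : (1 : ℝ) ≤ W := by exact_mod_cast hW
  have hdbl : layerGrowth L W ^ (2 * (L - 1) + 1) * layerGrowth L W = lam L W ^ 2 := by
    rw [hlam]; ring
  set A := layerGrowth L W
  set Λ := lam L W
  have hΛ4 : 4 ≤ Λ := hA4.trans hAΛ
  have hodd : A ^ (2 * (L - 1) + 1) ≤ Λ ^ 2 := by
    rw [← hdbl]
    exact le_mul_of_one_le_right (by positivity) (by linarith)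
  have e1 : 3 * W ^ 2 * A ^ (2 * (L - 1)) ≤ 3 / 4 * Λ ^ 2 := by
    calc 3 * W ^ 2 * A ^ (2 * (L - 1)) = 3 / 4 * (4 * W ^ 2 * A ^ (2 * (L - 1))) := by ring
      _ ≤ 3 / 4 * (A * A ^ (2 * (L - 1))) := by gcongr
      _ = 3 / 4 * A ^ (2 * (L - 1) + 1) := by ring
      _ ≤ _ := by gcongr
  have e2 : W * (A ^ (L - 1 + 1) + A) ≤ 1 / 2 * Λ ^ 2 := by
    rw [← hlam]
    calc W * (Λ + A) ≤ Λ / 4 * (Λ + Λ) := by gcongr; linarith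
      _ = _ := by ring
  have e3 : Real.exp (2 * (W ^ 2 * A ^ (L - 1))) ≤ Real.exp Λ :=
    Real.exp_le_exp.mpr (by linarith)
  have e4 : 3 * W * A ^ (2 * (L - 1) + 1) + W ^ 2 * A ^ (L - 1) ≤ Λ ^ 2 := by
    have h1 : 3 * W * A ^ (2 * (L - 1) + 1) ≤ 3 / 4 * Λ ^ 2 := by
      calc 3 * W * A ^ (2 * (L - 1) + 1) ≤ 3 * (A / 4) * A ^ (2 * (L - 1) + 1) := by gcongr
        _ = 3 / 4 * (A ^ (2 * (L - 1) + 1) * A) := by ring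
        _ = _ := by rw [hdbl]
    nlinarith
  have hexp : 1 ≤ Real.exp Λ := Real.one_le_exp (by linarith)
  calc _ ≤ d * (8 / 3) * (3 / 4 * Λ ^ 2 * (5 * (1 / 2 * Λ ^ 2 * p) * Real.exp Λ) + Λ ^ 2 * p) := by
        gcongr
    _ ≤ d * (8 / 3) * (3 / 4 * Λ ^ 2 * (5 * (1 / 2 * Λ ^ 2 * p) * Real.exp Λ) +
          Λ ^ 4 * Real.exp Λ * p) := by
        gcongr
        calc Λ ^ 2 ≤ Λ ^ 4 := pow_le_pow_right₀ (by linarith) (by norm_num)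
          _ ≤ Λ ^ 4 * Real.exp Λ := le_mul_of_one_le_right (by positivity) hexp
    _ = 23 / 3 * (d * Λ ^ 4 * Real.exp Λ) * p := by ring
    _ ≤ lamZ d L W / 4 * p := by
        gcongr
        have h1 : 4 * (d * Λ ^ 4 * Real.exp Λ) ≤ Λ * (d * Λ ^ 4 * Real.exp Λ) := by gcongr
        have h2 : 0 ≤ d * Λ ^ 4 * Real.exp Λ := by positivity
        linarith

lemma sup_bound_le (hd : 1 ≤ d) (hL : 1 ≤ L) (hW : 1 ≤ W) :
    d * (2 * (W ^ 2 * layerGrowth L W ^ (L - 1))) ≤ lamZ d L W / 4 := by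
  have hG := deriv_bound_le hL hW
  have hΛ4 : 4 ≤ lam L W := (four_le_layerGrowth hW).trans (layerGrowth_le_lam hL hW)
  have hexp : 1 ≤ Real.exp (lam L W) := Real.one_le_exp (by linarith)
  have h1 : d * lam L W ≤ d * lam L W ^ 5 * Real.exp (lam L W) := by
    calc d * lam L W ≤ d * lam L W ^ 5 := by
          gcongr
          exact le_self_pow₀ (by linarith) (by norm_num)
      _ ≤ _ := le_mul_of_one_le_right (by positivity) hexp
  have h2 : d * (2 * (W ^ 2 * layerGrowth L W ^ (L - 1))) ≤ d * (2 * (lam L W / 4)) := by gcongr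
  have h3 : 0 ≤ d * lam L W := by positivity
  linarith [le_lamZ hd hL hW]

end Constants

/-! ### Log-densities of the hypothesis space in network coordinates. -/

section HypSpace

variable {d L W m : ℕ}

/-- The logarithm of the Jacobian of the discretized flow of a network. -/
noncomputable def Net.logJac (N : Net) (d L W m : ℕ) (x : Vec d) : ℝ :=
  NeuralFlow.logJac (1 / m) (N.field d W (L - 1)) (N.fieldDeriv d W (L - 1)) m x

/-- The network `N` is bounded, and its discretized flow represents `ν`. -/
structure Net.Represents (N : Net) (L W m : ℕ) (ν : Measure (Vec d)) : Prop where
  le_width : d ≤ W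
  isBounded : N.IsBounded
  isSupported : N.IsSupported L W
  stepsMapTo : StepsMapTo (1 / m) (N.field d W (L - 1)) m
  isContDensity : IsContDensity ν fun x => Real.exp (N.logJac d L W m x)

lemma mul_one_div_le_one (m : ℕ) : (m : ℝ) * (1 / m) ≤ 1 := by
  rcases eq_or_ne (m : ℝ) 0 with h | h
  · simp [h]
  · rw [mul_one_div_cancel h]

lemma exists_represents (hd : 1 ≤ d) (hL : 1 ≤ L) (hW : 1 ≤ W) (hm : 1 ≤ m)
    (hstep : (1 / m : ℝ) < 1 / (2 * lam L W)) {ν : Measure (Vec d)}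
    (hν : ν ∈ hypSpace d L W m) : ∃ N : Net, N.Represents L W m ν := by
  obtain ⟨⟨hprob, -⟩, η, ⟨hdW, ℓ, hℓ, θ, hθ, rfl⟩, hbij, hmap⟩ := hν
  have hfield : θ.field = θ.toNet.field d W (L - 1) := (θ.field_toNet hℓ).symm
  rw [hfield] at hbij hmap
  exact ⟨θ.toNet, hdW, hθ.isBounded_toNet, θ.isSupported_toNet hL hdW hℓ,
    fun k hk => (hbij k hk).mapsTo,
    ((growthBound_radius hW (L - 1)).fieldBound hdW hd hθ.isBounded_toNet).isContDensity_logJac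
      (stepBound_of_lt hL hW hm hstep) (mul_one_div_le_one m) hbij hmap⟩

lemma Net.Represents.density_eqOn {N : Net} {ν : Measure (Vec d)} [IsProbabilityMeasure ν]
    (hN : N.Represents L W m ν) :
    EqOn (density ν) (fun x => Real.exp (N.logJac d L W m x)) (dom d) :=
  hN.isContDensity.isContDensity_density.eqOn hN.isContDensity

lemma Net.Represents.abs_logJac_le {N : Net} {ν : Measure (Vec d)} (hN : N.Represents L W m ν)
    (hd : 1 ≤ d) (hL : 1 ≤ L) (hW : 1 ≤ W) (hm : 1 ≤ m)
    (hstep : (1 / m : ℝ) < 1 / (2 * lam L W)) {x : Vec d} (hx : x ∈ dom d) :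
    |N.logJac d L W m x| ≤ lamZ d L W / 4 :=
  (((growthBound_radius hW (L - 1)).fieldBound hN.le_width hd hN.isBounded).abs_logJac_le
    (stepBound_of_lt hL hW hm hstep) (mul_one_div_le_one m) hN.stepsMapTo hx).trans
    (sup_bound_le hd hL hW)

lemma Net.Represents.abs_logJac_sub_le {N N' : Net} {ν ν' : Measure (Vec d)}
    (hN : N.Represents L W m ν) (hN' : N'.Represents L W m ν')
    (hd : 1 ≤ d) (hL : 1 ≤ L) (hW : 1 ≤ W) (hm : 1 ≤ m)
    (hstep : (1 / m : ℝ) < 1 / (2 * lam L W)) {p : ℝ} (hp : 0 ≤ p)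
    (h : ∀ q, |N.coord L W q - N'.coord L W q| ≤ p) {x : Vec d} (hx : x ∈ dom d) :
    |N.logJac d L W m x - N'.logJac d L W m x| ≤ lamZ d L W / 4 * p := by
  have hA := growthBound_radius hW (L - 1)
  have hA1 := hA.one_le
  have hNN := hN.isSupported.within hN'.isSupported hp h
  exact ((hA.fieldClose hN.le_width hd hN.isBounded hN'.isBounded hp hNN).abs_logJac_sub_le
    (hA.fieldBound hN.le_width hd hN.isBounded) (hA.fieldBound hN.le_width hd hN'.isBounded)
    (stepBound_of_lt hL hW hm hstep) (by positivity) (by positivity) (by positivity)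
    (mul_one_div_le_one m) hN.stepsMapTo hN'.stepsMapTo hx).trans
    (lipschitz_bound_le hd hL hW hp)

end HypSpace

end NeuralFlow

/-! ### The generalization bound. -/

open NeuralFlow in
theorem mainTheorem6 (d k L W m n : ℕ) (hd : 1 ≤ d) (hk : 4 ≤ k) (hL : 1 ≤ L) (hW : 1 ≤ W)
    (hm : 1 ≤ m) (hn : 1 ≤ n)
    (hstep : (1 / m : ℝ) < 1 / (2 * NeuralFlow.lam L W))
    (μ : Measure (NeuralFlow.Vec d)) (hμ : μ ∈ NeuralFlow.target d k)
    {S : Type*} [MeasurableSpace S] (P : Measure S) [IsProbabilityMeasure P]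
    (X : Fin n → S → NeuralFlow.Vec d) (hX : ∀ i, Measurable (X i))
    (hlaw : ∀ i, P.map (X i) = μ) (hindep : iIndepFun X P) :
    (∀ ν ∈ NeuralFlow.hypSpace d L W m,
      NeuralFlow.IsContDensity ν (NeuralFlow.density ν) ∧
      (∀ x ∈ NeuralFlow.dom d, 0 < NeuralFlow.density ν x) ∧
      Integrable (fun x => -Real.log (NeuralFlow.density ν x)) μ) ∧
    AEMeasurable (fun s => NeuralFlow.genError μ (NeuralFlow.hypSpace d L W m)
      (fun i => X i s)) P ∧
    ∫⁻ s, NeuralFlow.genError μ (NeuralFlow.hypSpace d L W m) (fun i => X i s) ∂P ≤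
      ENNReal.ofReal (48 * L * W ^ 2 * NeuralFlow.lamZ d L W / Real.sqrt n) := by
  obtain ⟨⟨hμp, hμd⟩, -⟩ := hμ
  have : Nonempty Net := ⟨⟨0, 0⟩⟩
  choose! N hN using fun ν (hν : ν ∈ hypSpace d L W m) => exists_represents hd hL hW hm hstep hν
  have hprob : ∀ ν ∈ hypSpace d L W m, IsProbabilityMeasure ν := fun ν hν => hν.1.1
  have hden : ∀ ν ∈ hypSpace d L W m, ∀ x ∈ dom d,
      density ν x = Real.exp ((N ν).logJac d L W m x) := fun ν hν x hx => by
    have := hprob ν hν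
    exact (hN ν hν).density_eqOn hx
  have hμae : ∀ᵐ x ∂μ, x ∈ dom d := by rwa [ae_iff]
  let H := hypSpace d L W m
  -- Densities are controlled only on the domain, whereas chaining wants globally measurable and
  -- bounded functions. Cutting off changes nothing almost surely, because `μ` and the samples live
  -- on the domain.
  let f : H → Vec d → ℝ := fun t => (dom d).indicator fun x => -Real.log (density t.1 x)
  have hlog : ∀ (t : H) x, x ∈ dom d → f t x = -(N t.1).logJac d L W m x := fun t x hx => by
    simp only [f, indicator_of_mem hx, hden t.1 t.2 x hx, Real.log_exp]
  have hf0 : ∀ (t : H) x, x ∉ dom d → f t x = 0 := fun t x hx => indicator_of_notMem hx _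
  have hcont : ∀ t : H, IsContDensity t.1 (density t.1) := fun t =>
    (hN t.1 t.2).isContDensity.isContDensity_density
  have hpos : ∀ (t : H), ∀ x ∈ dom d, 0 < density t.1 x := fun t x hx => by
    rw [hden t.1 t.2 x hx]; exact Real.exp_pos _
  have hfm : ∀ t, Measurable (f t) := fun t => by
    have h1 : ContinuousOn (fun x => -Real.log (density t.1 x)) (dom d) :=
      ((hcont t).1.log fun x hx => (hpos t x hx).ne').neg
    classical
    have h3 := h1.measurable_piecewise (g := 0) continuousOn_const
      measurableSet_dom
    simpa only [f, ← piecewise_eq_indicator] using h3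
  have hZ4 : 0 < lamZ d L W / 4 := by
    have h1 : 4 ≤ lam L W := (four_le_layerGrowth hW).trans (layerGrowth_le_lam hL hW)
    have h2 : (1 : ℝ) ≤ d := by exact_mod_cast hd
    exact div_pos (lt_of_lt_of_le (by positivity) (le_lamZ hd hL hW)) (by norm_num)
  have hfB : ∀ t x, |f t x| ≤ lamZ d L W / 4 := fun t x => by
    by_cases hx : x ∈ dom d
    · rw [hlog t x hx, abs_neg]
      exact (hN t.1 t.2).abs_logJac_le hd hL hW hm hstep hx
    · rw [hf0 t x hx, abs_zero]; exact hZ4.le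
  have hfK : ∀ (t t' : H) p, 0 ≤ p →
      (∀ q, |(N t.1).coord L W q - (N t'.1).coord L W q| ≤ p) →
      ∀ x, |f t x - f t' x| ≤ lamZ d L W / 4 * p := fun t t' p hp h x => by
    by_cases hx : x ∈ dom d
    · rw [hlog t x hx, hlog t' x hx, neg_sub_neg, abs_sub_comm]
      exact (hN t.1 t.2).abs_logJac_sub_le (hN t'.1 t'.2) hd hL hW hm hstep hp h hx
    · rw [hf0 t x hx, hf0 t' x hx, sub_zero, abs_zero]; positivity
  have hfae : ∀ t : H, f t =ᵐ[μ] fun x => -Real.log (density t.1 x) := fun t => by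
    filter_upwards [hμae] with x hx
    exact indicator_of_mem hx _
  have hgen : (fun s => genError μ H fun i => X i s) =ᵐ[P]
      fun s => ⨆ t : H, ENNReal.ofReal |deviation μ X (f t) s| := by
    have hXd : ∀ᵐ s ∂P, ∀ i, X i s ∈ dom d := by
      rw [ae_all_iff]
      intro i
      rw [← hlaw i] at hμae
      exact ae_of_ae_map (hX i).aemeasurable hμae
    filter_upwards [hXd] with s hs
    rw [genError, iSup_subtype']
    refine iSup_congr fun t => ?_
    rw [risk, empRisk, deviation, integral_congr_ae (hfae t)]
    congr 5
    funext i
    exact (indicator_of_mem (hs i) fun x => -Real.log (density t.1 x)).symm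
  refine ⟨fun ν hν => ⟨hcont ⟨ν, hν⟩, hpos ⟨ν, hν⟩,
    (integrable_of_abs_le (hfm ⟨ν, hν⟩) (hfB ⟨ν, hν⟩)).congr (hfae ⟨ν, hν⟩)⟩, ?_⟩
  -- Chaining needs a representative, hence a nonempty class; over an empty class the supremum in
  -- `[0, ∞]` is `0`.
  rcases isEmpty_or_nonempty H with hH | hH
  · have h0 : (fun s => genError μ H fun i => X i s) =ᵐ[P] fun _ => 0 := by
      filter_upwards [hgen] with s hs
      rw [hs, iSup_of_empty]; rfl
    exact ⟨aemeasurable_const.congr h0.symm, by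
      rw [lintegral_congr_ae h0, lintegral_zero]; exact zero_le⟩
  · have : Nonempty (Fin L × Fin W × Fin (W + 2)) := ⟨(⟨0, hL⟩, ⟨0, hW⟩, 0)⟩
    refine ⟨(measurable_iSup_deviation hn hX hfm hfB hfK).aemeasurable.congr hgen.symm, ?_⟩
    rw [lintegral_congr_ae hgen]
    refine (lintegral_iSup_deviation_le hn hX hlaw hindep
      (fun t q => (hN t.1 t.2).isBounded.abs_coord_le L W q) hfm hZ4 hZ4 hfB hfK).trans ?_
    apply ENNReal.ofReal_le_ofReal
    have hcard : ((Fintype.card (Fin L × Fin W × Fin (W + 2)) : ℕ) : ℝ) ≤ 3 * L * W ^ 2 := by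
      simp only [Fintype.card_prod, Fintype.card_fin]
      have : L * (W * (W + 2)) ≤ 3 * L * W ^ 2 := by nlinarith [Nat.mul_le_mul_left (L * W) hW]
      exact_mod_cast this
    have hZ : 0 < lamZ d L W := by linarith
    refine div_le_div_of_nonneg_right ?_ (Real.sqrt_nonneg _)
    -- The dimension is at most `3 * L * W ^ 2` because `W + 2 ≤ 3 * W`; then `3 * (4 + 14) / 4 = 27
    -- / 2`, below the claimed `48`.
    calc _ ≤ 3 * L * W ^ 2 * (4 * (lamZ d L W / 4) + 14 * (lamZ d L W / 4)) := by gcongr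
      _ = 27 / 2 * (L * W ^ 2 * lamZ d L W) := by ring
      _ ≤ 48 * (L * W ^ 2 * lamZ d L W) := by gcongr; norm_num
      _ = _ := by ring
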